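/- Let $d\ge 1$, $0<\theta<d/4$, and let $\eta(x)$, $x\in\mathbb R^d$, be a jointly measurable zero-mean real Gaussian random field with the Cauchy covariance function $\operatorname{Cov}(\eta(x),\eta(y))=B(\|x-y\|)$, $B(r)=(1+r^2)^{-\theta}$. Put $\alpha=2\theta$ and $L(t)=(1+t^{-2})^{-\theta}$, $t>0$, and for $t>0$ let $$f(t)=\frac{t^{\theta-d/2}}{2^{d/2+\theta-1}\pi^{d/2}\Gamma(\theta)}\,K_{d/2-\theta}(t),\qquad c_2(d,\alpha)=\frac{\Gamma((d-\alpha)/2)}{2^{\alpha}\pi^{d/2}\Gamma(\alpha/2)},$$ where $K_\mu$ is the modified Bessel function of the second kind. For $\delta\in(0,2)$ define $$\upsilon=\begin{cases} d-2\theta, & d\in\{1,2\},\ \text{or } d=3 \text{ and } \theta>1/2,\\ 2-\delta, & d=3 \text{ and } \theta=1/2,\\ 2, & \text{otherwise.}\end{cases}$$ Then the following hold. (1) (Assumption 1.) $\eta$ is a measurable, mean square continuous, zero-mean homogeneous isotropic Gaussian field, $B(0)=1$, $\mathbf E\,\eta(0)\eta(x)=\|x\|^{-\alpha}L(\|x\|)$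 for $x\ne0$, and $L:(0,\infty)\to(0,\infty)$ is measurable and slowly varying at infinity. (2) (Assumption 2.) For every $\delta\in(0,2)$ and every $q\in(0,2]$: $f$ is an isotropic spectral density of $\eta$, that is, $f\ge0$, $u^{d-1}f(u)\in L_1(0,\infty)$ and $B(r)=\int_0^\infty Y_d(rz)\,d\Phi(z)$ with $d\Phi(u)=2\pi^{d/2}\Gamma(d/2)^{-1}u^{d-1}f(u)\,du$ and $Y_d(z)=2^{(d-2)/2}\Gamma(d/2)J_{(d-2)/2}(z)z^{(2-d)/2}$ (with $Y_d(0)=1$); $\upsilon>0$ and $$f(t)=c_2(d,\alpha)\,t^{\alpha-d}L(1/t)+t^{\alpha-d}L(1/t)\cdot O(\min(t^{\upsilon},1)),\qquad \max(t,1/t)\to+\infty;$$ $L$ is slowly varying and bounded on every interval $(0,a]$; and there are constants $C,\nu$ and $r_0>0$ with $|1-L(tr)/L(r)|\le C\,t^{\nu}/r^{q}$ for all $r\ge r_0$, $t\ge1$. (3) If $d/2-\theta\notin\mathbb N$, then $\upsilon=\min(2,d-2\theta)$. If $d/2-\theta\in\mathbb N$, then $\upsilon=2-\delta$ when $d=3$,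 $\theta=1/2$, and $\upsilon=2$ otherwise. (4) As $t\to0+$, the ratio $h(t)=f(t)/(c_2(d,2\theta)\,t^{2\theta-d})$ satisfies $$h(t)-1=\begin{cases}-\dfrac{2^{2\theta-d}\,\Gamma(\theta-\frac{d-2}{2})}{\Gamma(\frac{d+2}{2}-\theta)}\,t^{d-2\theta}+o(t^{d-2\theta}), & d/2-\theta<1,\\[2mm] \tfrac12\,t^2\ln t+o(t^2\ln t), & d/2-\theta=1,\\[1mm] \dfrac{t^2}{2(2+2\theta-d)}+o(t^2), & d/2-\theta>1.\end{cases}$$ (5) Let $\varkappa_1(\upsilon,q)=2\min\Bigl(q,\bigl(\tfrac{2}{d-2\alpha}+\tfrac{2}{d+1-2\alpha}+\tfrac1\upsilon\bigr)^{-1}\Bigr)$. For every $\delta\in(0,2)$ there is $q_0$ with $0<q_0<\min(2,d/2-\alpha)$ such that for all $q\in[q_0,2]$ with $q<d/2-\alpha$ $$\varkappa_1(\upsilon,q)=2\bigl(2(d-2\alpha)^{-1}+2(d+1-2\alpha)^{-1}+\upsilon^{-1}\bigr)^{-1}.$$ Moreover, for every real $$\varkappa<\tfrac13\min\Bigl(\tfrac{\alpha(d-2\alpha)}{d-\alpha},\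 2\bigl(2(d-2\alpha)^{-1}+2(d+1-2\alpha)^{-1}+\min(2,d-2\theta)^{-1}\bigr)^{-1}\Bigr)$$ there are $\delta\in(0,2)$ and $q\in(0,2]$ with $q<d/2-\alpha$ such that $\varkappa<\tfrac13\min\bigl(\tfrac{\alpha(d-2\alpha)}{d-\alpha},\varkappa_1(\upsilon,q)\bigr)$. -/

import Mathlib

open Real Set Filter Topology MeasureTheory ProbabilityTheory Asymptotics

noncomputable section

/-- Bessel function of the first kind `J_ν(z)`, for `z > 0`. -/
def besselJ (ν z : ℝ) : ℝ :=
  ∑' k : ℕ, (-1 : ℝ) ^ k / (k.factorial * Real.Gamma (k + ν + 1)) * (z / 2) ^ (2 * (k : ℝ) + ν)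

/-- Modified Bessel function of the second kind `K_μ(t)`, for `t > 0`. -/
def besselK (μ t : ℝ) : ℝ :=
  ∫ s in Ioi (0 : ℝ), Real.exp (-(t * Real.cosh s)) * Real.cosh (μ * s)

/-- The kernel `Y_d(z) = 2^((d-2)/2) Γ(d/2) J_((d-2)/2)(z) z^((2-d)/2)`, `z ≥ 0`, whose value at
`z = 0` is its limit `1`. -/
def isotropicKernel (d : ℕ) (z : ℝ) : ℝ :=
  if z = 0 then 1
  else 2 ^ (((d : ℝ) - 2) / 2) * Real.Gamma ((d : ℝ) / 2) * besselJ (((d : ℝ) - 2) / 2) z *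
    z ^ ((2 - (d : ℝ)) / 2)

/-- The isotropic spectral measure `Φ` with density `f`: on `(0, ∞)`,
`dΦ(u) = 2 π^(d/2) Γ(d/2)⁻¹ u^(d-1) f(u) du`. -/
def isotropicSpectralMeasure (d : ℕ) (f : ℝ → ℝ) : Measure ℝ :=
  (volume.restrict (Ioi (0 : ℝ))).withDensity fun u =>
    ENNReal.ofReal (2 * π ^ ((d : ℝ) / 2) / Real.Gamma ((d : ℝ) / 2) * (u ^ ((d : ℝ) - 1) * f u))

/-- `η` is a measurable, mean square continuous, zero-mean, homogeneous and isotropic (in the wide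
sense) real random field on `ℝ^d`. -/
structure IsHomogeneousIsotropicField {d : ℕ} {Ω : Type*} [MeasurableSpace Ω] (P : Measure Ω)
    (η : EuclideanSpace ℝ (Fin d) → Ω → ℝ) : Prop where
  measurable : Measurable (Function.uncurry η)
  memLp : ∀ x, MemLp (η x) 2 P
  mean_zero : ∀ x, ∫ ω, η x ω ∂P = 0
  meanSquareContinuous : ∀ x, Tendsto (fun y => ∫ ω, (η y ω - η x ω) ^ 2 ∂P) (𝓝 x) (𝓝 0)
  homogeneousIsotropic : ∃ B : ℝ → ℝ, ∀ x y, cov[η x, η y; P] = B ‖x - y‖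

/-- `f` is an isotropic spectral density of the field `η`:
`Cov(η x, η y) = ∫ Y_d(‖x - y‖ z) dΦ(z)` with `Φ` having density `f` and `u^(d-1) f(u)` in
`L¹(0, ∞)`. -/
structure HasIsotropicSpectralDensity {d : ℕ} {Ω : Type*} [MeasurableSpace Ω] (P : Measure Ω)
    (η : EuclideanSpace ℝ (Fin d) → Ω → ℝ) (f : ℝ → ℝ) : Prop where
  nonneg : ∀ u, 0 < u → 0 ≤ f u
  integrable : IntegrableOn (fun u => u ^ ((d : ℝ) - 1) * f u) (Ioi 0)
  covariance_eq : ∀ x y, cov[η x, η y; P] =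
    ∫ z, isotropicKernel d (‖x - y‖ * z) ∂(isotropicSpectralMeasure d f)

/-- `L : (0, ∞) → (0, ∞)` is measurable and slowly varying at infinity. -/
structure IsSlowlyVarying (L : ℝ → ℝ) : Prop where
  measurable : Measurable fun t : Ioi (0 : ℝ) => L t
  pos : ∀ t, 0 < t → 0 < L t
  tendsto : ∀ t, 0 < t → Tendsto (fun r => L (r * t) / L r) atTop (𝓝 1)

/-- The covariance assumption: `η` is a homogeneous isotropic zero-mean Gaussian field whose covariance function
`B(x) = E η(0) η(x)` satisfies `B(0) = 1` and `B(x) = ‖x‖^(-α) L(‖x‖)`, with `L` slowly varying. -/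
structure CovarianceAssumption {d : ℕ} {Ω : Type*} [MeasurableSpace Ω] (P : Measure Ω)
    (η : EuclideanSpace ℝ (Fin d) → Ω → ℝ) (α : ℝ) (L : ℝ → ℝ) : Prop where
  field : IsHomogeneousIsotropicField P η
  gaussian : IsGaussianProcess η P
  cov_zero : ∫ ω, η 0 ω * η 0 ω ∂P = 1
  cov_eq : ∀ x, x ≠ 0 → ∫ ω, η 0 ω * η x ω ∂P = ‖x‖ ^ (-α) * L ‖x‖
  slowlyVarying : IsSlowlyVarying L

/-- `c₂(d, α) = Γ((d-α)/2) / (2^α π^(d/2) Γ(α/2))`. -/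
def c₂ (d : ℕ) (α : ℝ) : ℝ :=
  Real.Gamma (((d : ℝ) - α) / 2) / (2 ^ α * π ^ ((d : ℝ) / 2) * Real.Gamma (α / 2))

/-- The spectral density assumption for the field `η`, with spectral density `f`, and with parameters `α`, `L`, `υ`
and `q`. The filter `𝓝[>] 0 ⊔ atTop` is `max(t, 1/t) → +∞`. -/
structure SpectralDensityAssumption {d : ℕ} {Ω : Type*} [MeasurableSpace Ω] (P : Measure Ω)
    (η : EuclideanSpace ℝ (Fin d) → Ω → ℝ) (f : ℝ → ℝ) (α : ℝ) (L : ℝ → ℝ) (υ q : ℝ) : Prop where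
  spectralDensity : HasIsotropicSpectralDensity P η f
  υ_pos : 0 < υ
  remainder :
    (fun t => f t - c₂ d α * t ^ (α - d) * L (1 / t)) =O[𝓝[>] 0 ⊔ atTop]
      fun t => t ^ (α - d) * L (1 / t) * min (t ^ υ) 1
  locallyBounded : ∀ a, 0 < a → ∃ M, ∀ t, 0 < t → t ≤ a → |L t| ≤ M
  slowlyVarying : IsSlowlyVarying L
  q_pos : 0 < q
  slowVariationRate : ∃ C ν r₀ : ℝ, 0 < r₀ ∧ ∀ r t, r₀ ≤ r → 1 ≤ t →
    |1 - L (t * r) / L r| ≤ C * t ^ ν / r ^ q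

/-- The exponent `ϰ₁` for the parameters `d`, `α`, `υ` and `q`. -/
def kappa₁ (d : ℕ) (α υ q : ℝ) : ℝ :=
  2 * min q (2 / (d - 2 * α) + 2 / (d + 1 - 2 * α) + 1 / υ)⁻¹

/-- `L(t) = (1 + t^(-2))^(-θ)`. -/
def cauchyL (θ t : ℝ) : ℝ := (1 + t ^ (-2 : ℝ)) ^ (-θ)

/-- The spectral density of the Cauchy model, as a function of `t = ‖λ‖ > 0`. -/
def cauchyDensity (d : ℕ) (θ t : ℝ) : ℝ :=
  t ^ (θ - (d : ℝ) / 2) /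
      (2 ^ ((d : ℝ) / 2 + θ - 1) * π ^ ((d : ℝ) / 2) * Real.Gamma θ) *
    besselK ((d : ℝ) / 2 - θ) t

open Classical in
/-- The exponent `υ` of the Cauchy model; `δ` only matters in the logarithmic case
`d = 3`, `θ = 1/2`. -/
def cauchyUpsilon (d : ℕ) (θ δ : ℝ) : ℝ :=
  if d = 1 ∨ d = 2 ∨ (d = 3 ∧ 1 / 2 < θ) then d - 2 * θ
  else if d = 3 ∧ θ = 1 / 2 then 2 - δ
  else 2

end

/-!
Everything rests on the integral `G(μ, x) = ∫₀^∞ u^(μ-1) exp (-u - x/u) du` (`gammaBessel`), which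
at `x = t²/4` equals `2 (t/2)^μ K_μ(t)` for every real `μ` (`gammaBessel_eq_besselK`). Since
`K_μ = K_(-μ)`, the density `f` has two expressions through it, with `μ = d/2 - θ`.

With index `μ`, `f(t) = c₂ t^(2θ-d) G(μ, t²/4) / Γ(μ)` (`cauchyDensity_eq_c₂_mul`), so the behaviour
of `f` at frequency zero is that of `G(μ, x) - Γ(μ)` as `x → 0`. For `μ > 1` one differentiates
under the integral; for `μ < 1` the substitution `u = x/w` pulls out `x^μ` and leaves an integral
whose limit is `-Γ(1-μ)/μ`; for `μ = 1` an elementary two-sided estimate gives `x log x + O(x)`.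
Together with the exponential decay `gammaBessel_le` and the triviality `1 - L(1/t) = O(t²)` this
yields the remainder estimate, `υ` being at most the order of both errors.

With index `-μ`, `f` is a mixture of Gaussian densities with gamma weights
(`cauchyDensity_eq_gammaBessel_neg`). Integrating the power series of `Y_d` term by term against a
Gaussian of variance `2s` gives `exp (-s r²)` (`integral_isotropicKernel_mul_gaussian`), and
integrating this against `s^(θ-1) e^(-s) ds / Γ(θ)` gives `(1 + r²)^(-θ)`, the covariance
(`integral_isotropicKernel_isotropicSpectralMeasure`). Exchanging the two integrals requires `Y_d`
to be bounded, which follows from Poisson's integral for Bessel functions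
(`hasSum_isotropicTerm`).

The statements on `υ` are a case distinction on `d/2 - θ` being less than, equal to or greater than
`1`; equality forces `d = 3`, `θ = 1/2` because `θ < d/4`. Those on `ϰ₁` use that its second entry
is less than `2` and `d/2 - 2θ`, and continuity at `δ = 0`.
-/

/-! ### The integral `∫ u^(μ-1) exp (-u - x/u) du` -/

/-- The integral `∫₀^∞ u^(μ-1) exp (-u - x/u) du`, a perturbation of Euler's integral for `Γ(μ)`
which at `x = t²/4` equals `2 (t/2)^μ K_μ(t)`. -/
noncomputable def gammaBessel (μ x : ℝ) : ℝ :=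
  ∫ u in Ioi (0 : ℝ), u ^ (μ - 1) * exp (-u - x / u)

lemma integrableOn_gammaBessel (μ : ℝ) {x : ℝ} (hx : 0 < x) :
    IntegrableOn (fun u : ℝ => u ^ (μ - 1) * exp (-u - x / u)) (Ioi 0) := by
  obtain ⟨n, hn⟩ := exists_nat_gt (-μ)
  have h1 : IntegrableOn (fun u : ℝ => (n.factorial / x ^ n) * (exp (-u) * u ^ (μ + n - 1)))
      (Ioi 0) := (Real.GammaIntegral_convergent (by linarith)).const_mul _
  refine Integrable.mono' h1 ?_ ?_
  · exact Measurable.aestronglyMeasurable (by fun_prop)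
  · filter_upwards [self_mem_ae_restrict measurableSet_Ioi] with u (hu : 0 < u)
    have h2 : exp (-(x / u)) ≤ n.factorial / x ^ n * u ^ n := by
      have h3 := Real.pow_div_factorial_le_exp (x / u) (by positivity) n
      rw [exp_neg, inv_le_comm₀ (exp_pos _) (by positivity)]
      refine le_trans (le_of_eq ?_) h3
      rw [div_pow]
      field_simp
    rw [norm_of_nonneg (by positivity), sub_eq_add_neg (-u), exp_add,
      show μ + n - 1 = (μ - 1) + n by ring, rpow_add hu, rpow_natCast]
    calc u ^ (μ - 1) * (exp (-u) * exp (-(x / u)))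
        ≤ u ^ (μ - 1) * (exp (-u) * (n.factorial / x ^ n * u ^ n)) := by gcongr
      _ = _ := by ring

/-- The substitution `u = (t/2) e^s` turns the exponent `-u - t²/(4u)` into `-t cosh s`. -/
lemma gammaBessel_eq_besselK (μ : ℝ) {t : ℝ} (ht : 0 < t) :
    gammaBessel μ (t ^ 2 / 4) = 2 * (t / 2) ^ μ * besselK μ t := by
  set F : ℝ → ℝ := fun s => (t / 2) ^ μ * (exp (μ * s) * exp (-(t * cosh s))) with hF
  have himg : (fun s : ℝ => t / 2 * exp s) '' univ = Ioi 0 := by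
    ext u
    simp only [image_univ, mem_range, mem_Ioi]
    constructor
    · rintro ⟨s, rfl⟩; positivity
    · intro hu
      refine ⟨log (u / (t / 2)), ?_⟩
      rw [exp_log (by positivity)]
      field_simp
  have hder : ∀ s ∈ (univ : Set ℝ),
      HasDerivWithinAt (fun s : ℝ => t / 2 * exp s) (t / 2 * exp s) univ s :=
    fun s _ => ((hasDerivAt_exp s).const_mul _).hasDerivWithinAt
  have hinj : InjOn (fun s : ℝ => t / 2 * exp s) univ := by
    intro a _ b _ h
    have h' : t / 2 * exp a = t / 2 * exp b := h
    exact exp_injective (mul_left_cancel₀ (by positivity) h')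
  have hpt : ∀ s : ℝ, |t / 2 * exp s| • ((t / 2 * exp s) ^ (μ - 1) *
      exp (-(t / 2 * exp s) - t ^ 2 / 4 / (t / 2 * exp s))) = F s := by
    intro s
    have hp : 0 < t / 2 * exp s := by positivity
    rw [abs_of_pos hp, smul_eq_mul, ← mul_assoc, rpow_sub_one hp.ne', mul_div_cancel₀ _ hp.ne',
      mul_rpow (by positivity) (exp_pos s).le, ← exp_mul, hF]
    have : -(t / 2 * exp s) - t ^ 2 / 4 / (t / 2 * exp s) = -(t * cosh s) := by
      rw [cosh_eq, exp_neg]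
      field_simp
      ring
    simp only [this, mul_comm s μ]
    ring
  have hint : Integrable F := by
    have h := integrableOn_gammaBessel μ (show 0 < t ^ 2 / 4 by positivity)
    rw [← himg, integrableOn_image_iff_integrableOn_abs_deriv_smul MeasurableSet.univ hder hinj,
      integrableOn_univ] at h
    simpa only [hpt] using h
  have h1 : gammaBessel μ (t ^ 2 / 4) = ∫ s, F s := by
    rw [gammaBessel, ← himg, integral_image_eq_integral_abs_deriv_smul MeasurableSet.univ hder hinj,
      Measure.restrict_univ]
    simp only [hpt]
  have h2 := integral_comp_neg_Ioi 0 F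
  rw [neg_zero] at h2
  rw [h1, ← intervalIntegral.integral_Iic_add_Ioi hint.integrableOn hint.integrableOn (b := 0), ← h2,
    ← integral_add hint.comp_neg.integrableOn hint.integrableOn, besselK, ← integral_const_mul]
  refine setIntegral_congr_fun measurableSet_Ioi fun s _ => ?_
  simp only [hF, cosh_neg, cosh_eq (μ * s), mul_neg]
  ring

lemma besselK_neg (μ t : ℝ) : besselK (-μ) t = besselK μ t := by
  simp only [besselK, neg_mul, cosh_neg]

lemma gammaBessel_nonneg (μ x : ℝ) : 0 ≤ gammaBessel μ x :=
  setIntegral_nonneg measurableSet_Ioi fun u (hu : 0 < u) => by positivity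

/-- Since `u/2 + t²/(4u) ≥ t/2`, the integral decays exponentially in `t`. -/
lemma gammaBessel_le {μ : ℝ} (hμ : 0 < μ) {t : ℝ} (ht : 0 < t) :
    gammaBessel μ (t ^ 2 / 4) ≤ 2 ^ μ * Gamma μ * exp (-(t / 2)) := by
  have h0 : ∫ u in Ioi (0 : ℝ), u ^ (μ - 1) * exp (-(2⁻¹ * u)) = 2 ^ μ * Gamma μ := by
    rw [integral_rpow_mul_exp_neg_mul_Ioi hμ (by norm_num)]
    norm_num
  have h1 : IntegrableOn (fun u : ℝ => u ^ (μ - 1) * exp (-(2⁻¹ * u))) (Ioi 0) := by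
    have := integrableOn_rpow_mul_exp_neg_mul_rpow (s := μ - 1) (p := 1) (b := 2⁻¹)
      (by linarith) one_pos (by norm_num)
    simpa [neg_mul] using this
  rw [← h0, ← integral_mul_const]
  refine setIntegral_mono_on (integrableOn_gammaBessel μ (by positivity)) (h1.mul_const _)
    measurableSet_Ioi fun u (hu : 0 < u) => ?_
  rw [mul_assoc, ← exp_add]
  gcongr
  have h3 : 0 ≤ 2⁻¹ * u + t ^ 2 / 4 / u - t / 2 := by
    have : 2⁻¹ * u + t ^ 2 / 4 / u - t / 2 = ((u - t) ^ 2 + u ^ 2) / (4 * u) := by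
      field_simp
      ring
    rw [this]; positivity
  linarith

/-! ### Behaviour of the integral as `x → 0` -/

lemma one_sub_exp_neg_nonneg {a : ℝ} (ha : 0 ≤ a) : 0 ≤ 1 - exp (-a) := by
  have := exp_le_one_iff.2 (neg_nonpos.2 ha)
  linarith

lemma one_sub_exp_neg_le (a : ℝ) : 1 - exp (-a) ≤ a := by
  have := add_one_le_exp (-a)
  linarith

lemma integrableOn_Gamma_sub_gammaBessel {μ x : ℝ} (hμ : 0 < μ) (hx : 0 < x) :
    IntegrableOn (fun u : ℝ => u ^ (μ - 1) * exp (-u) * (1 - exp (-(x / u)))) (Ioi 0) := by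
  refine ((Real.GammaIntegral_convergent hμ).sub (integrableOn_gammaBessel μ hx)).congr_fun
    (fun u _ => ?_) measurableSet_Ioi
  simp only [Pi.sub_apply, sub_eq_add_neg (-u), exp_add]
  ring

lemma Gamma_sub_gammaBessel {μ x : ℝ} (hμ : 0 < μ) (hx : 0 < x) :
    Gamma μ - gammaBessel μ x =
      ∫ u in Ioi (0 : ℝ), u ^ (μ - 1) * exp (-u) * (1 - exp (-(x / u))) := by
  rw [Gamma_eq_integral hμ, gammaBessel,
    ← integral_sub (Real.GammaIntegral_convergent hμ) (integrableOn_gammaBessel μ hx)]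
  refine setIntegral_congr_fun measurableSet_Ioi fun u _ => ?_
  simp only [sub_eq_add_neg (-u), exp_add]
  ring

/-- For `μ > 1` the difference quotient at `0` passes under the integral, as `u^(μ-2) e^(-u)` is
still integrable. -/
lemma tendsto_gammaBessel_of_one_lt {μ : ℝ} (hμ : 1 < μ) :
    Tendsto (fun x => (gammaBessel μ x - Gamma μ) / x) (𝓝[>] 0) (𝓝 (-Gamma (μ - 1))) := by
  have h : Tendsto (fun x => ∫ u in Ioi (0 : ℝ), u ^ (μ - 1) * exp (-u) * (1 - exp (-(x / u))) / x)
      (𝓝[>] 0) (𝓝 (∫ u in Ioi (0 : ℝ), u ^ (μ - 1) * exp (-u) * (1 / u))) := by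
    refine tendsto_integral_filter_of_dominated_convergence
      (fun u => u ^ (μ - 1) * exp (-u) * (1 / u)) ?_ ?_ ?_ ?_
    · exact Eventually.of_forall fun x => Measurable.aestronglyMeasurable (by fun_prop)
    · filter_upwards [self_mem_nhdsWithin] with x (hx : 0 < x)
      filter_upwards [self_mem_ae_restrict measurableSet_Ioi] with u (hu : 0 < u)
      have h0 := one_sub_exp_neg_nonneg (show 0 ≤ x / u by positivity)
      rw [norm_of_nonneg (by positivity), mul_div_assoc]
      refine mul_le_mul_of_nonneg_left ?_ (by positivity)
      rw [div_le_iff₀ hx]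
      exact (one_sub_exp_neg_le _).trans_eq (by ring)
    · refine (Real.GammaIntegral_convergent (sub_pos.2 hμ)).congr_fun (fun u (hu : 0 < u) => ?_)
        measurableSet_Ioi
      simp only [rpow_sub_one hu.ne']
      ring
    · filter_upwards [self_mem_ae_restrict measurableSet_Ioi] with u (hu : 0 < u)
      have hd : HasDerivAt (fun x : ℝ => 1 - exp (-(x / u))) (1 / u) 0 := by
        have h1 : HasDerivAt (fun x : ℝ => -(x / u)) (-(1 / u)) 0 :=
          ((hasDerivAt_id _).div_const u).neg
        simpa using h1.exp.const_sub 1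
      have h2 := hd.tendsto_slope_zero_right
      simp only [zero_add, zero_div, neg_zero, exp_zero, sub_self, sub_zero, smul_eq_mul] at h2
      refine (h2.const_mul (u ^ (μ - 1) * exp (-u))).congr fun x => ?_
      ring
  have hΓ : ∫ u in Ioi (0 : ℝ), u ^ (μ - 1) * exp (-u) * (1 / u) = Gamma (μ - 1) := by
    rw [Gamma_eq_integral (sub_pos.2 hμ)]
    refine setIntegral_congr_fun measurableSet_Ioi fun u (hu : 0 < u) => ?_
    simp only [rpow_sub_one hu.ne']
    ring
  rw [hΓ] at h
  refine h.neg.congr' ?_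
  filter_upwards [self_mem_nhdsWithin] with x (hx : 0 < x)
  rw [integral_div, ← Gamma_sub_gammaBessel (by linarith) hx]
  ring

lemma integrableOn_rpow_mul_one_sub_exp_neg {μ : ℝ} (hμ0 : 0 < μ) (hμ1 : μ < 1) :
    IntegrableOn (fun w : ℝ => w ^ (-μ - 1) * (1 - exp (-w))) (Ioi 0) := by
  have hm : ∀ s : Set ℝ, AEStronglyMeasurable (fun w : ℝ => w ^ (-μ - 1) * (1 - exp (-w)))
    (volume.restrict s) := fun s => Measurable.aestronglyMeasurable (by fun_prop)
  rw [← Ioc_union_Ioi_eq_Ioi zero_le_one, integrableOn_union]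
  constructor
  · have h := intervalIntegral.intervalIntegrable_rpow' (a := 0) (b := 1) (r := -μ) (by linarith)
    rw [intervalIntegrable_iff_integrableOn_Ioc_of_le zero_le_one] at h
    refine Integrable.mono' h (hm _) ?_
    filter_upwards [self_mem_ae_restrict measurableSet_Ioc] with w hw
    have hw0 : 0 < w := hw.1
    have h0 := one_sub_exp_neg_nonneg hw0.le
    rw [norm_of_nonneg (by positivity), rpow_sub_one hw0.ne', div_mul_eq_mul_div,
      div_le_iff₀ hw0]
    gcongr
    exact one_sub_exp_neg_le w
  · refine Integrable.mono' (integrableOn_Ioi_rpow_of_lt (a := -μ - 1) (by linarith) one_pos)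
      (hm _) ?_
    filter_upwards [self_mem_ae_restrict measurableSet_Ioi] with w (hw : 1 < w)
    have hw0 : 0 < w := one_pos.trans hw
    have h0 := one_sub_exp_neg_nonneg hw0.le
    rw [norm_of_nonneg (by positivity)]
    refine mul_le_of_le_one_right (by positivity) ?_
    linarith [exp_pos (-w)]

/-- Integration by parts, with antiderivative `-w^(-μ) (1 - e^(-w)) / μ` vanishing at both ends. -/
lemma integral_rpow_mul_one_sub_exp_neg {μ : ℝ} (hμ0 : 0 < μ) (hμ1 : μ < 1) :
    ∫ w in Ioi (0 : ℝ), w ^ (-μ - 1) * (1 - exp (-w)) = Gamma (1 - μ) / μ := by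
  have hi1 := integrableOn_rpow_mul_one_sub_exp_neg hμ0 hμ1
  have hi2 : IntegrableOn (fun w : ℝ => exp (-w) * w ^ (1 - μ - 1) / μ) (Ioi 0) :=
    (Real.GammaIntegral_convergent (show 0 < 1 - μ by linarith)).div_const μ
  have h := integral_Ioi_of_hasDerivAt_of_tendsto (a := 0) (m := 0)
    (f := fun w : ℝ => -(w ^ (-μ) * (1 - exp (-w))) / μ)
    (f' := fun w : ℝ => w ^ (-μ - 1) * (1 - exp (-w)) - exp (-w) * w ^ (1 - μ - 1) / μ)
    ?_ ?_ (hi1.sub hi2) ?_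
  · rw [integral_sub hi1 hi2, integral_div, ← Gamma_eq_integral (by linarith)] at h
    simp only [neg_zero, exp_zero, sub_self, mul_zero, zero_div] at h
    linarith
  · have hlim : Tendsto (fun w : ℝ => w ^ (1 - μ)) (𝓝[≥] 0) (𝓝 0) := by
      have := (continuousAt_rpow_const (0 : ℝ) (1 - μ) (Or.inr (by linarith))).tendsto
      rw [zero_rpow (by linarith)] at this
      exact this.mono_left nhdsWithin_le_nhds
    have hlim' : Tendsto (fun w : ℝ => w ^ (-μ) * (1 - exp (-w))) (𝓝[≥] 0) (𝓝 0) := by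
      refine squeeze_zero' ?_ ?_ hlim
      · filter_upwards [self_mem_nhdsWithin] with w (hw : 0 ≤ w)
        exact mul_nonneg (rpow_nonneg hw _) (one_sub_exp_neg_nonneg hw)
      · filter_upwards [self_mem_nhdsWithin] with w (hw : 0 ≤ w)
        rcases hw.eq_or_lt with rfl | hw
        · simp [zero_rpow (show 1 - μ ≠ 0 by linarith)]
        · rw [show 1 - μ = -μ + 1 by ring, rpow_add_one hw.ne']
          gcongr
          exact one_sub_exp_neg_le w
    have := hlim'.neg.div_const μ
    unfold ContinuousWithinAt
    simpa using this
  · intro w (hw : 0 < w)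
    have h1 : HasDerivAt (fun w : ℝ => w ^ (-μ)) (-μ * w ^ (-μ - 1)) w :=
      hasDerivAt_rpow_const (Or.inl hw.ne')
    have h2 : HasDerivAt (fun w : ℝ => 1 - exp (-w)) (exp (-w)) w := by
      simpa using ((hasDerivAt_neg w).exp).const_sub 1
    convert! (h1.mul h2).neg.div_const μ using 1
    rw [show 1 - μ - 1 = -μ by ring]
    field_simp
    ring
  · have hlim : Tendsto (fun w : ℝ => w ^ (-μ)) atTop (𝓝 0) := tendsto_rpow_neg_atTop hμ0
    have hlim' : Tendsto (fun w : ℝ => w ^ (-μ) * (1 - exp (-w))) atTop (𝓝 0) := by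
      refine squeeze_zero' ?_ ?_ hlim
      · filter_upwards [eventually_ge_atTop 0] with w hw
        exact mul_nonneg (rpow_nonneg hw _) (one_sub_exp_neg_nonneg hw)
      · filter_upwards [eventually_ge_atTop 0] with w hw
        refine mul_le_of_le_one_right (rpow_nonneg hw _) ?_
        linarith [exp_pos (-w)]
    simpa using hlim'.neg.div_const μ

/-- The substitution `u = x / w` pulls out the power `x^μ`. -/
lemma Gamma_sub_gammaBessel_eq_rpow_mul {μ x : ℝ} (hμ : 0 < μ) (hx : 0 < x) :
    Gamma μ - gammaBessel μ x =
      x ^ μ * ∫ w in Ioi (0 : ℝ), w ^ (-μ - 1) * (1 - exp (-w)) * exp (-(x / w)) := by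
  rw [Gamma_sub_gammaBessel hμ hx]
  set g : ℝ → ℝ := fun u => u ^ (μ - 1) * exp (-u) * (1 - exp (-(x / u))) with hg
  have h1 := integral_comp_mul_left_Ioi' g 0 hx
  rw [mul_zero] at h1
  rw [← h1, ← integral_comp_rpow_Ioi (fun v => g (x * v)) (show (-1 : ℝ) ≠ 0 by norm_num),
    smul_eq_mul, ← integral_const_mul, ← integral_const_mul]
  refine setIntegral_congr_fun measurableSet_Ioi fun w (hw : 0 < w) => ?_
  have h2 : x / (x * w⁻¹) = w := by field_simp
  have h3 : (x * w⁻¹) ^ (μ - 1) = x ^ μ / x * (w ^ (-μ) * w) := by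
    rw [mul_rpow hx.le (by positivity), rpow_sub_one hx.ne', inv_rpow hw.le, ← rpow_neg hw.le,
      ← rpow_add_one hw.ne']
    ring_nf
  have h4 : w ^ (-1 - 1 : ℝ) = (w ^ 2)⁻¹ := by
    rw [show (-1 - 1 : ℝ) = -(2 : ℕ) by norm_num, rpow_neg hw.le, rpow_natCast]
  simp only [hg, rpow_neg_one, h2, h3, h4, smul_eq_mul, abs_neg, abs_one, rpow_sub_one hw.ne']
  rw [show x / w = x * w⁻¹ from div_eq_mul_inv x w]
  field_simp

lemma tendsto_gammaBessel_of_lt_one {μ : ℝ} (hμ0 : 0 < μ) (hμ1 : μ < 1) :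
    Tendsto (fun x => (gammaBessel μ x - Gamma μ) / x ^ μ) (𝓝[>] 0)
      (𝓝 (-(Gamma (1 - μ) / μ))) := by
  have h : Tendsto (fun x => ∫ w in Ioi (0 : ℝ), w ^ (-μ - 1) * (1 - exp (-w)) * exp (-(x / w)))
      (𝓝[>] 0) (𝓝 (∫ w in Ioi (0 : ℝ), w ^ (-μ - 1) * (1 - exp (-w)))) := by
    refine tendsto_integral_filter_of_dominated_convergence
      (fun w => w ^ (-μ - 1) * (1 - exp (-w))) ?_ ?_
      (integrableOn_rpow_mul_one_sub_exp_neg hμ0 hμ1) ?_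
    · exact Eventually.of_forall fun x => Measurable.aestronglyMeasurable (by fun_prop)
    · filter_upwards [self_mem_nhdsWithin] with x (hx : 0 < x)
      filter_upwards [self_mem_ae_restrict measurableSet_Ioi] with w (hw : 0 < w)
      have h0 := one_sub_exp_neg_nonneg hw.le
      rw [norm_of_nonneg (by positivity)]
      refine mul_le_of_le_one_right (by positivity) (exp_le_one_iff.2 ?_)
      rw [neg_nonpos]
      positivity
    · filter_upwards with w
      have hc : Continuous fun x : ℝ => w ^ (-μ - 1) * (1 - exp (-w)) * exp (-(x / w)) := by
        fun_prop
      have := hc.tendsto 0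
      simp only [zero_div, neg_zero, exp_zero, mul_one] at this
      exact this.mono_left nhdsWithin_le_nhds
  rw [integral_rpow_mul_one_sub_exp_neg hμ0 hμ1] at h
  refine h.neg.congr' ?_
  filter_upwards [self_mem_nhdsWithin] with x (hx : 0 < x)
  have := Gamma_sub_gammaBessel_eq_rpow_mul hμ0 hx
  rw [eq_div_iff (by positivity), ← neg_sub (Gamma μ), this]
  ring

/-- The logarithm comes from `∫ du / u` over `(x, 1)`, where `1 - exp (-x/u)` is comparable to
`x/u` and `e^(-u)` to `1`. -/
lemma abs_gammaBessel_one_sub_le {x : ℝ} (hx0 : 0 < x) (hx1 : x < 1) :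
    |gammaBessel 1 x - 1 - x * log x| ≤ 2 * x := by
  have hD := Gamma_sub_gammaBessel one_pos hx0
  have hi := integrableOn_Gamma_sub_gammaBessel one_pos hx0
  simp only [sub_self, rpow_zero, one_mul, Gamma_one] at hD hi
  set g : ℝ → ℝ := fun u => exp (-u) * (1 - exp (-(x / u))) with hg
  have hg0 : ∀ u, 0 < u → 0 ≤ g u := fun u hu =>
    mul_nonneg (exp_pos _).le (one_sub_exp_neg_nonneg (by positivity))
  have hsub : ∀ a, 0 ≤ a → ∀ s ⊆ Ioi a, IntegrableOn g s :=
    fun a ha s hs => hi.mono_set (hs.trans (Ioi_subset_Ioi ha))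
  have hexp : ∀ u, 0 < u → exp (-u) ≤ 1 := fun u hu => exp_le_one_iff.2 (by linarith)
  have hle1 : ∀ u, 0 < u → g u ≤ 1 := fun u hu =>
    mul_le_one₀ (hexp u hu) (one_sub_exp_neg_nonneg (by positivity))
      (by linarith [exp_pos (-(x / u))])
  have hle2 : ∀ u, 0 < u → g u ≤ exp (-u) * (x / u) := fun u hu =>
    mul_le_mul_of_nonneg_left (one_sub_exp_neg_le _) (exp_pos _).le
  have hii : ∀ a b, 0 ≤ a → a ≤ b → IntervalIntegrable g volume a b := fun a b ha hab => by
    rw [intervalIntegrable_iff_integrableOn_Ioc_of_le hab]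
    exact hsub a ha _ Ioc_subset_Ioi_self
  have hsplit1 : ∫ u in Ioi (0 : ℝ), g u = (∫ u in (0 : ℝ)..1, g u) + ∫ u in Ioi (1 : ℝ), g u := by
    rw [intervalIntegral.integral_of_le zero_le_one,
      ← setIntegral_union Ioc_disjoint_Ioi_same measurableSet_Ioi
        (hsub 0 le_rfl _ Ioc_subset_Ioi_self) (hsub 1 zero_le_one _ subset_rfl),
      Ioc_union_Ioi_eq_Ioi zero_le_one]
  have hsplit2 : ∫ u in (0 : ℝ)..1, g u = (∫ u in (0 : ℝ)..x, g u) + ∫ u in x..1, g u :=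
    (intervalIntegral.integral_add_adjacent_intervals (hii 0 x le_rfl hx0.le)
      (hii x 1 hx0.le hx1.le)).symm
  have hup1 : ∫ u in (0 : ℝ)..x, g u ≤ x := by
    have := intervalIntegral.integral_mono_on_of_le_Ioo hx0.le (hii 0 x le_rfl hx0.le)
      (intervalIntegrable_const (c := (1 : ℝ))) fun u hu => hle1 u hu.1
    simpa using this
  have hup2 : ∫ u in x..1, g u ≤ -(x * log x) := by
    have hci : IntervalIntegrable (fun u : ℝ => x * u⁻¹) volume x 1 := by
      refine (intervalIntegral.intervalIntegrable_inv (fun u hu => ?_) continuousOn_id).const_mul x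
      rw [uIcc_of_le hx1.le] at hu
      exact (hx0.trans_le hu.1).ne'
    have := intervalIntegral.integral_mono_on hx1.le (hii x 1 hx0.le hx1.le) hci fun u hu => by
      have hu0 : 0 < u := hx0.trans_le hu.1
      refine (hle2 u hu0).trans ?_
      rw [← div_eq_mul_inv]
      exact mul_le_of_le_one_left (by positivity) (hexp u hu0)
    rw [intervalIntegral.integral_const_mul, integral_inv_of_pos hx0 one_pos, one_div,
      log_inv] at this
    linarith
  have hup3 : ∫ u in Ioi (1 : ℝ), g u ≤ x := by
    have h1 : ∫ u in Ioi (1 : ℝ), g u ≤ ∫ u in Ioi (1 : ℝ), x * exp (-u) := by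
      refine setIntegral_mono_on (hsub 1 zero_le_one _ subset_rfl)
        ((integrableOn_exp_neg_Ioi 1).const_mul x) measurableSet_Ioi fun u (hu : 1 < u) => ?_
      refine (hle2 u (one_pos.trans hu)).trans ?_
      rw [mul_comm]
      gcongr
      exact div_le_self hx0.le hu.le
    rw [integral_const_mul, integral_exp_neg_Ioi] at h1
    exact h1.trans (mul_le_of_le_one_right hx0.le (hexp 1 one_pos))
  have hlow3 : 0 ≤ ∫ u in Ioi (1 : ℝ), g u :=
    setIntegral_nonneg measurableSet_Ioi fun u (hu : 1 < u) => hg0 u (one_pos.trans hu)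
  have hlow : -(x * log x) - x ≤ ∫ u in (0 : ℝ)..1, g u := by
    have hne : ∀ u ∈ uIcc (0 : ℝ) 1, u + x ≠ 0 := fun u hu => by
      rw [uIcc_of_le zero_le_one] at hu
      linarith [hu.1]
    have hci : IntervalIntegrable (fun u : ℝ => (u + x)⁻¹) volume 0 1 :=
      intervalIntegral.intervalIntegrable_inv hne (by fun_prop)
    have hci' : IntervalIntegrable (fun u : ℝ => x * (1 + x) * (u + x)⁻¹ - x) volume 0 1 :=
      (hci.const_mul _).sub intervalIntegrable_const
    have h1 := intervalIntegral.integral_mono_on_of_le_Ioo zero_le_one hci'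
      (hii 0 1 le_rfl zero_le_one) fun u hu => by
        have hu0 : 0 < u := hu.1
        have h2 : x / (u + x) ≤ 1 - exp (-(x / u)) := by
          have h3 : exp (-(x / u)) ≤ u / (u + x) := by
            rw [exp_neg, inv_le_comm₀ (exp_pos _) (by positivity)]
            refine le_trans (le_of_eq ?_) (add_one_le_exp (x / u))
            field_simp
            ring
          have h4 : x / (u + x) = 1 - u / (u + x) := by field_simp; ring
          linarith
        have h5 : 1 - u ≤ exp (-u) := one_sub_le_exp_neg u
        calc x * (1 + x) * (u + x)⁻¹ - x = (1 - u) * (x / (u + x)) := by field_simp; ring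
          _ ≤ exp (-u) * (1 - exp (-(x / u))) := by gcongr
    rw [intervalIntegral.integral_sub (hci.const_mul _) intervalIntegrable_const,
      intervalIntegral.integral_const_mul,
      intervalIntegral.integral_comp_add_right (fun u : ℝ => u⁻¹), zero_add,
      integral_inv_of_pos hx0 (by linarith), log_div (by positivity) hx0.ne'] at h1
    simp only [intervalIntegral.integral_const, sub_zero, smul_eq_mul, one_mul] at h1
    have h6 : 0 ≤ log (1 + x) := log_nonneg (by linarith)
    have h7 : log x ≤ 0 := log_nonpos hx0.le hx1.le
    nlinarith [mul_nonneg hx0.le h6, mul_nonneg (mul_nonneg hx0.le hx0.le) h6,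
      mul_nonneg (mul_nonneg hx0.le hx0.le) (neg_nonneg.2 h7)]
  rw [abs_le]
  constructor <;> linarith

lemma tendsto_gammaBessel_one :
    Tendsto (fun x => (gammaBessel 1 x - 1) / (x * log x)) (𝓝[>] 0) (𝓝 1) := by
  have hlog : Tendsto (fun x : ℝ => (2 : ℝ) / |log x|) (𝓝[>] 0) (𝓝 0) :=
    tendsto_const_nhds.div_atTop (tendsto_abs_atBot_atTop.comp tendsto_log_nhdsGT_zero)
  refine tendsto_iff_norm_sub_tendsto_zero.2 (squeeze_zero' (Eventually.of_forall fun _ =>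
    norm_nonneg _) ?_ hlog)
  filter_upwards [Ioo_mem_nhdsGT one_pos] with x hx
  have h1 := abs_gammaBessel_one_sub_le hx.1 hx.2
  have hl : log x < 0 := log_neg hx.1 hx.2
  have hx0 : 0 < x := hx.1
  have h2 : (gammaBessel 1 x - 1) / (x * log x) - 1 =
      (gammaBessel 1 x - 1 - x * log x) / (x * log x) := by
    rw [sub_div _ (x * log x), div_self (mul_ne_zero hx0.ne' hl.ne)]
  rw [h2, norm_eq_abs, abs_div, abs_mul, abs_of_pos hx0,
    div_le_div_iff₀ (mul_pos hx0 (abs_pos.2 hl.ne)) (abs_pos.2 hl.ne)]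
  calc _ ≤ 2 * x * |log x| := by gcongr
    _ = _ := by ring

/-! ### The kernel `Y_d`: power series, boundedness and Gaussian averages -/

lemma integrableOn_betaIntegrand {a b : ℝ} (ha : 0 < a) (hb : 0 < b) :
    IntegrableOn (fun v : ℝ => v ^ (a - 1) * (1 - v) ^ (b - 1)) (Ioo 0 1) ∧
      ∫ v in Ioo (0 : ℝ) 1, v ^ (a - 1) * (1 - v) ^ (b - 1) = beta a b := by
  have hβ := beta_pos ha hb
  have hl := lintegral_betaPDF_eq_one ha hb
  rw [lintegral_betaPDF] at hl
  have hm : AEStronglyMeasurable (fun v : ℝ => 1 / beta a b * v ^ (a - 1) * (1 - v) ^ (b - 1))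
      (volume.restrict (Ioo 0 1)) := Measurable.aestronglyMeasurable (by fun_prop)
  have hn : 0 ≤ᵐ[volume.restrict (Ioo 0 1)]
      (fun v : ℝ => 1 / beta a b * v ^ (a - 1) * (1 - v) ^ (b - 1)) := by
    filter_upwards [self_mem_ae_restrict measurableSet_Ioo] with v hv
    have h0 : 0 < v := hv.1
    have h1 : 0 < 1 - v := sub_pos.2 hv.2
    show 0 ≤ 1 / beta a b * v ^ (a - 1) * (1 - v) ^ (b - 1)
    positivity
  have hi := (lintegral_ofReal_ne_top_iff_integrable hm hn).1 (by rw [hl]; simp)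
  have hI := integral_eq_lintegral_of_nonneg_ae hn hm
  rw [hl, ENNReal.toReal_one] at hI
  simp only [mul_assoc] at hi hI
  rw [integral_const_mul] at hI
  refine ⟨?_, ?_⟩
  · refine (hi.const_mul (beta a b)).congr (Eventually.of_forall fun v => ?_)
    simp only
    field_simp
  · field_simp at hI
    exact hI

/-- The `k`-th term of the power series of `Y_d`. -/
noncomputable def isotropicTerm (d k : ℕ) (x : ℝ) : ℝ :=
  (-1) ^ k * (Gamma (d / 2) / (k.factorial * Gamma (k + d / 2)) * (x / 2) ^ (2 * k))

lemma isotropicKernel_eq_tsum {d : ℕ} (hd : 0 < d) {x : ℝ} (hx : 0 ≤ x) :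
    isotropicKernel d x = ∑' k, isotropicTerm d k x := by
  have hΓ : Gamma ((d : ℝ) / 2) ≠ 0 := (Gamma_pos_of_pos (by positivity)).ne'
  rcases hx.eq_or_lt with rfl | hx
  · rw [isotropicKernel, if_pos rfl, tsum_eq_single 0]
    · simp [isotropicTerm, hΓ]
    · intro k hk
      simp [isotropicTerm, hk]
  · rw [isotropicKernel, if_neg hx.ne', besselJ, ← tsum_mul_left, ← tsum_mul_right]
    refine tsum_congr fun k => ?_
    have h1 : (x / 2) ^ (2 * (k : ℝ) + ((d : ℝ) - 2) / 2) =
        (x / 2) ^ (2 * k) * (x ^ (((d : ℝ) - 2) / 2) / 2 ^ (((d : ℝ) - 2) / 2)) := by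
      rw [rpow_add (by positivity), div_rpow hx.le zero_le_two (((d : ℝ) - 2) / 2)]
      congr 1
      exact_mod_cast rpow_natCast (x / 2) (2 * k)
    have h2 : x ^ ((2 - (d : ℝ)) / 2) = (x ^ (((d : ℝ) - 2) / 2))⁻¹ := by
      rw [← rpow_neg hx.le]
      ring_nf
    have h3 : (k : ℝ) + ((d : ℝ) - 2) / 2 + 1 = k + d / 2 := by ring
    rw [h1, h2, h3, isotropicTerm]
    have hp : x ^ (((d : ℝ) - 2) / 2) ≠ 0 := (rpow_pos_of_pos hx _).ne'
    have hq : (2 : ℝ) ^ (((d : ℝ) - 2) / 2) ≠ 0 := (rpow_pos_of_pos two_pos _).ne'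
    field_simp

/-- Legendre's duplication formula at a half-integer. -/
lemma factorial_mul_Gamma_nat_add_half (k : ℕ) :
    (k.factorial : ℝ) * Gamma (k + 1 / 2) * 2 ^ (2 * k) = √π * (2 * k).factorial := by
  have h := Real.Gamma_mul_Gamma_add_half ((k : ℝ) + 1 / 2)
  rw [show (k : ℝ) + 1 / 2 + 1 / 2 = k + 1 by ring, Gamma_nat_eq_factorial,
    show 2 * ((k : ℝ) + 1 / 2) = (2 * k : ℕ) + 1 by push_cast; ring, Gamma_nat_eq_factorial,
    show 1 - ((2 * k : ℕ) + 1 : ℝ) = -((2 * k : ℕ) : ℝ) by ring, rpow_neg zero_le_two,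
    rpow_natCast] at h
  rw [mul_comm (k.factorial : ℝ), h]
  field_simp

/-- In dimension one `Y_1 = cos`; in dimension `d ≥ 2` Poisson's integral writes `Y_d` as an
average of cosines `cos (x √v)` against a beta distribution. -/
lemma hasSum_isotropicTerm {d : ℕ} (hd : 0 < d) (x : ℝ) :
    ∃ y, |y| ≤ 1 ∧ HasSum (fun k => isotropicTerm d k x) y := by
  rcases (show d = 1 ∨ 2 ≤ d by omega) with rfl | hd2
  · refine ⟨cos x, abs_cos_le_one x, ?_⟩
    convert! Real.hasSum_cos x using 2 with k
    have h := factorial_mul_Gamma_nat_add_half k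
    have hΓ : 0 < Gamma ((k : ℝ) + 1 / 2) := Gamma_pos_of_pos (by positivity)
    rw [isotropicTerm, Nat.cast_one, Gamma_one_half_eq, div_pow, mul_div_assoc]
    congr 1
    rw [div_mul_div_comm, div_eq_div_iff (by positivity) (by positivity)]
    linear_combination -x ^ (2 * k) * h
  · set b : ℝ := ((d : ℝ) - 1) / 2 with hb
    have hb0 : 0 < b := by
      have : (2 : ℝ) ≤ d := by exact_mod_cast hd2
      rw [hb]; linarith
    have ha0 : (0 : ℝ) < 1 / 2 := by norm_num
    have hβ := beta_pos ha0 hb0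
    obtain ⟨hwi, hwI⟩ := integrableOn_betaIntegrand ha0 hb0
    set w : ℝ → ℝ := fun v => v ^ ((1 : ℝ) / 2 - 1) * (1 - v) ^ (b - 1) with hw
    have hw0 : ∀ v ∈ Ioo (0 : ℝ) 1, 0 ≤ w v := fun v hv => by
      have h0 : 0 < v := hv.1
      have h1 : 0 < 1 - v := sub_pos.2 hv.2
      positivity
    refine ⟨(∫ v in Ioo (0 : ℝ) 1, cos (x * √v) * w v) / beta (1 / 2) b, ?_, ?_⟩
    · rw [abs_div, abs_of_pos hβ, div_le_one hβ, ← hwI, ← norm_eq_abs]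
      refine norm_integral_le_of_norm_le hwi ?_
      filter_upwards [self_mem_ae_restrict measurableSet_Ioo] with v hv
      rw [norm_mul, norm_of_nonneg (hw0 v hv)]
      exact mul_le_of_le_one_left (hw0 v hv) (abs_cos_le_one _)
    · have hs := hasSum_integral_of_dominated_convergence
        (μ := volume.restrict (Ioo (0 : ℝ) 1))
        (F := fun k v => (-1) ^ k * (x * √v) ^ (2 * k) / (2 * k).factorial * w v)
        (f := fun v => cos (x * √v) * w v)
        (fun k v => x ^ (2 * k) / (2 * k).factorial * w v) ?_ ?_ ?_ ?_ ?_
      · convert! hs.div_const (beta (1 / 2) b) using 2 with k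
        have hk0 : (0 : ℝ) < k + 1 / 2 := by positivity
        have h1 : ∫ v in Ioo (0 : ℝ) 1, (-1) ^ k * (x * √v) ^ (2 * k) / (2 * k).factorial * w v =
            (-1) ^ k * x ^ (2 * k) / (2 * k).factorial * beta (k + 1 / 2) b := by
          rw [← (integrableOn_betaIntegrand hk0 hb0).2, ← integral_const_mul]
          refine setIntegral_congr_fun measurableSet_Ioo fun v hv => ?_
          have h0 : 0 < v := hv.1
          simp only [hw]
          rw [show (k : ℝ) + 1 / 2 - 1 = k + (1 / 2 - 1) by ring, rpow_add h0, rpow_natCast, mul_pow,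
            pow_mul (√v), sq_sqrt h0.le]
          ring
        have h := factorial_mul_Gamma_nat_add_half k
        have hΓ1 : 0 < Gamma ((k : ℝ) + 1 / 2) := Gamma_pos_of_pos hk0
        have hΓ2 : 0 < Gamma b := Gamma_pos_of_pos hb0
        have hΓ3 : 0 < Gamma ((d : ℝ) / 2) := Gamma_pos_of_pos (by positivity)
        have hΓ4 : 0 < Gamma ((k : ℝ) + d / 2) := Gamma_pos_of_pos (by positivity)
        rw [h1, isotropicTerm, beta, beta, Gamma_one_half_eq,
          show (k : ℝ) + 1 / 2 + b = k + d / 2 by rw [hb]; ring,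
          show (1 : ℝ) / 2 + b = d / 2 by rw [hb]; ring, div_pow]
        generalize Gamma ((k : ℝ) + 1 / 2) = G at h hΓ1 ⊢
        field_simp
        linear_combination -x ^ (2 * k) * h
      · exact fun k => Measurable.aestronglyMeasurable (by fun_prop)
      · intro k
        filter_upwards [self_mem_ae_restrict measurableSet_Ioo] with v hv
        rw [norm_mul, norm_of_nonneg (hw0 v hv), norm_div, norm_mul, norm_pow, norm_neg, norm_one,
          one_pow, one_mul, norm_of_nonneg ((even_two_mul k).pow_nonneg _), Real.norm_natCast, mul_pow,
          pow_mul √v, sq_sqrt hv.1.le]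
        refine mul_le_mul_of_nonneg_right ?_ (hw0 v hv)
        gcongr
        exact mul_le_of_le_one_right ((even_two_mul k).pow_nonneg _)
          (pow_le_one₀ hv.1.le hv.2.le)
      · exact Eventually.of_forall fun v => (Real.hasSum_cosh x).summable.mul_right _
      · simp only [tsum_mul_right]
        exact hwi.const_mul _
      · exact Eventually.of_forall fun v => (Real.hasSum_cos (x * √v)).mul_right _

lemma abs_tsum_isotropicTerm_le_one {d : ℕ} (hd : 0 < d) (x : ℝ) :
    |∑' k, isotropicTerm d k x| ≤ 1 := by
  obtain ⟨y, hy, hs⟩ := hasSum_isotropicTerm hd x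
  rwa [hs.tsum_eq]

lemma measurable_tsum_isotropicTerm {d : ℕ} (hd : 0 < d) :
    Measurable fun x => ∑' k, isotropicTerm d k x := by
  refine measurable_of_tendsto_metrizable
    (f := fun n x => ∑ k ∈ Finset.range n, isotropicTerm d k x) (fun n => ?_) ?_
  · unfold isotropicTerm
    fun_prop
  · refine tendsto_pi_nhds.2 fun x => ?_
    obtain ⟨y, -, hs⟩ := hasSum_isotropicTerm hd x
    rw [hs.tsum_eq]
    exact hs.tendsto_sum_nat

/-- The Gaussian density is, up to scaling, its own Fourier transform: the radial form, obtained by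
integrating the power series of `Y_d` term by term. -/
lemma integral_isotropicKernel_mul_gaussian {d : ℕ} (hd : 0 < d) {r s : ℝ} (hr : 0 ≤ r)
    (hs : 0 < s) :
    ∫ z in Ioi (0 : ℝ), isotropicKernel d (r * z) * (z ^ ((d : ℝ) - 1) * exp (-(z ^ 2 / 4 / s))) =
      Gamma (d / 2) * 2 ^ ((d : ℝ) - 1) * s ^ ((d : ℝ) / 2) * exp (-(s * r ^ 2)) := by
  have hd' : (0 : ℝ) < d := by exact_mod_cast hd
  have hΓ : 0 < Gamma ((d : ℝ) / 2) := Gamma_pos_of_pos (by positivity)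
  set A : ℝ := Gamma (d / 2) * 2 ^ ((d : ℝ) - 1) * s ^ ((d : ℝ) / 2) with hA
  set c : ℕ → ℝ := fun k => Gamma (d / 2) / (k.factorial * Gamma (k + d / 2)) * (r / 2) ^ (2 * k)
    with hc
  set m : ℕ → ℝ → ℝ := fun k z => z ^ (2 * (k : ℝ) + d - 1) * exp (-(4 * s)⁻¹ * z ^ (2 : ℝ)) with hm
  have hmi : ∀ k, IntegrableOn (m k) (Ioi 0) := fun k =>
    integrableOn_rpow_mul_exp_neg_mul_rpow (by have : (0 : ℝ) ≤ k := k.cast_nonneg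
                                               linarith) two_pos (by positivity)
  have hmI : ∀ k, c k * ∫ z in Ioi 0, m k z = A * ((s * r ^ 2) ^ k / k.factorial) := fun k => by
    have hΓ' : 0 < Gamma ((k : ℝ) + d / 2) := Gamma_pos_of_pos (by positivity)
    rw [integral_rpow_mul_exp_neg_mul_rpow two_pos
      (by have : (0 : ℝ) ≤ k := k.cast_nonneg
          linarith) (by positivity),
      show (2 * (k : ℝ) + d - 1 + 1) / 2 = k + d / 2 by ring,
      show -(2 * (k : ℝ) + d - 1 + 1) / 2 = -(k + d / 2) by ring,
      inv_rpow (by positivity), rpow_neg (by positivity), inv_inv, rpow_add (by positivity),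
      rpow_natCast, mul_rpow (by norm_num) hs.le,
      show (4 : ℝ) ^ ((d : ℝ) / 2) = 2 ^ ((d : ℝ) - 1) * 2 by
        rw [← rpow_add_one two_ne_zero, show (4 : ℝ) = 2 ^ (2 : ℝ) by norm_num,
          ← rpow_mul zero_le_two]
        ring_nf, hA, hc]
    simp only [pow_mul, mul_pow, div_pow]
    norm_num
    field_simp
  have hF : ∀ k, ∀ z ∈ Ioi (0 : ℝ), isotropicTerm d k (r * z) *
      (z ^ ((d : ℝ) - 1) * exp (-(z ^ 2 / 4 / s))) = (-1) ^ k * (c k * m k z) := by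
    intro k z (hz : 0 < z)
    have h1 : -(z ^ 2 / 4 / s) = -(4 * s)⁻¹ * z ^ 2 := by field_simp
    simp only [isotropicTerm, hc, hm, rpow_two, h1]
    rw [show 2 * (k : ℝ) + d - 1 = (2 * k : ℕ) + (d - 1) by push_cast; ring, rpow_add hz,
      rpow_natCast, show r * z / 2 = r / 2 * z by ring, mul_pow]
    ring
  have hsum := hasSum_integral_of_summable_integral_norm (μ := volume.restrict (Ioi (0 : ℝ)))
    (F := fun k z => (-1) ^ k * (c k * m k z)) (fun k => ((hmi k).const_mul _).const_mul _) ?_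
  · simp only [integral_const_mul, hmI] at hsum
    have hexp : HasSum (fun k : ℕ => (-1) ^ k * (A * ((s * r ^ 2) ^ k / k.factorial)))
        (A * exp (-(s * r ^ 2))) := by
      have := (NormedSpace.expSeries_div_hasSum_exp (-(s * r ^ 2))).mul_left A
      rw [← exp_eq_exp_ℝ] at this
      refine this.congr_fun fun k => ?_
      rw [neg_pow]
      ring
    rw [hexp.unique hsum]
    refine setIntegral_congr_fun measurableSet_Ioi fun z (hz : 0 < z) => ?_
    rw [isotropicKernel_eq_tsum hd (by positivity), ← tsum_mul_right]
    exact tsum_congr fun k => hF k z hz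
  · have h1 : ∀ k, ∫ z in Ioi 0, ‖(-1) ^ k * (c k * m k z)‖ =
        A * ((s * r ^ 2) ^ k / k.factorial) := fun k => by
      rw [← hmI, ← integral_const_mul]
      refine setIntegral_congr_fun measurableSet_Ioi fun z (hz : 0 < z) => ?_
      have hΓ' : 0 < Gamma ((k : ℝ) + d / 2) := Gamma_pos_of_pos (by positivity)
      have hck : 0 ≤ c k := by simp only [hc]; positivity
      have hmk : 0 ≤ m k z := by simp only [hm]; positivity
      simp only [norm_mul, norm_pow, norm_neg, norm_one, one_pow, one_mul, norm_of_nonneg hck,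
        norm_of_nonneg hmk]
    simp only [h1]
    exact (Real.summable_pow_div_factorial _).mul_left A

/-! ### The spectral density of the Cauchy covariance -/

lemma c₂_pos {d : ℕ} {θ : ℝ} (hθ : 0 < θ) (hμ : 0 < (d : ℝ) / 2 - θ) : 0 < c₂ d (2 * θ) := by
  have h1 : 0 < Gamma (((d : ℝ) - 2 * θ) / 2) := Gamma_pos_of_pos (by linarith)
  have h2 : 0 < Gamma (2 * θ / 2) := Gamma_pos_of_pos (by linarith)
  unfold c₂
  positivity

lemma cauchyDensity_eq_c₂_mul {d : ℕ} {θ t : ℝ} (hθ : 0 < θ) (hμ : 0 < (d : ℝ) / 2 - θ)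
    (ht : 0 < t) :
    cauchyDensity d θ t = c₂ d (2 * θ) * t ^ (2 * θ - d) *
      (gammaBessel ((d : ℝ) / 2 - θ) (t ^ 2 / 4) / Gamma ((d : ℝ) / 2 - θ)) := by
  have hΓμ : 0 < Gamma ((d : ℝ) / 2 - θ) := Gamma_pos_of_pos hμ
  have hΓθ : 0 < Gamma θ := Gamma_pos_of_pos hθ
  rw [gammaBessel_eq_besselK _ ht, cauchyDensity, c₂,
    show ((d : ℝ) - 2 * θ) / 2 = d / 2 - θ by ring, show 2 * θ / 2 = θ by ring,
    show 2 * θ - (d : ℝ) = (θ - d / 2) + -(d / 2 - θ) by ring, rpow_add ht, rpow_neg ht.le,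
    div_rpow ht.le zero_le_two]
  have h2 : (2 : ℝ) ^ (2 * θ) * 2 ^ ((d : ℝ) / 2 - θ) = 2 ^ ((d : ℝ) / 2 + θ - 1) * 2 := by
    rw [← rpow_add two_pos, ← rpow_add_one two_ne_zero]
    ring_nf
  have hp : t ^ ((d : ℝ) / 2 - θ) ≠ 0 := (rpow_pos_of_pos ht _).ne'
  have h3 : (2 : ℝ) ^ ((d : ℝ) / 2 + θ - 1) = 2 ^ (2 * θ) * 2 ^ ((d : ℝ) / 2 - θ) / 2 := by
    rw [h2]; ring
  rw [h3]
  generalize Gamma ((d : ℝ) / 2 - θ) = G at hΓμ ⊢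
  generalize besselK ((d : ℝ) / 2 - θ) t = K
  field_simp

/-- The spectral density as a mixture of Gaussian densities of variance `2s` with respect to the
gamma distribution `s^(θ-1) e^(-s) ds / Γ(θ)`. -/
lemma cauchyDensity_eq_gammaBessel_neg {d : ℕ} {θ t : ℝ} (ht : 0 < t) :
    cauchyDensity d θ t =
      (2 ^ d * π ^ ((d : ℝ) / 2) * Gamma θ)⁻¹ * gammaBessel (θ - (d : ℝ) / 2) (t ^ 2 / 4) := by
  rw [gammaBessel_eq_besselK _ ht, ← besselK_neg, neg_sub, cauchyDensity, div_rpow ht.le zero_le_two]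
  have h2 : (2 : ℝ) ^ ((d : ℝ) / 2 + θ - 1) = 2 ^ d * 2 ^ (θ - (d : ℝ) / 2) / 2 := by
    rw [← rpow_natCast, ← rpow_add two_pos, ← rpow_sub_one two_ne_zero]
    ring_nf
  rw [h2, mul_inv, mul_inv, div_eq_mul_inv, mul_inv, mul_inv, div_eq_mul_inv, div_eq_mul_inv,
    mul_inv, mul_inv, inv_inv]
  ring

lemma integrable_gaussian_gamma_mixture {d : ℕ} (hd : 0 < d) {θ : ℝ} (hθ : 0 < θ) :
    Integrable (fun p : ℝ × ℝ => p.1 ^ ((d : ℝ) - 1) *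
        (p.2 ^ (θ - (d : ℝ) / 2 - 1) * exp (-p.2 - p.1 ^ 2 / 4 / p.2)))
      ((volume.restrict (Ioi 0)).prod (volume.restrict (Ioi 0))) := by
  have hd' : (0 : ℝ) < d := by exact_mod_cast hd
  have hfac : ∀ s z : ℝ, z ^ ((d : ℝ) - 1) * (s ^ (θ - (d : ℝ) / 2 - 1) *
      exp (-s - z ^ 2 / 4 / s)) = s ^ (θ - (d : ℝ) / 2 - 1) * exp (-s) *
        (z ^ ((d : ℝ) - 1) * exp (-(z ^ 2 / 4 / s))) := fun s z => by
    rw [sub_eq_add_neg (-s), exp_add]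
    ring
  rw [integrable_prod_iff' (Measurable.aestronglyMeasurable (by fun_prop))]
  constructor
  · filter_upwards [self_mem_ae_restrict measurableSet_Ioi] with s (hs : 0 < s)
    have h := integrableOn_rpow_mul_exp_neg_mul_rpow (s := (d : ℝ) - 1) (p := 2) (b := (4 * s)⁻¹)
      (by linarith) two_pos (by positivity)
    refine (h.const_mul (s ^ (θ - (d : ℝ) / 2 - 1) * exp (-s))).congr
      (Eventually.of_forall fun z => ?_)
    simp only [hfac, rpow_two]
    rw [show -(4 * s)⁻¹ * z ^ 2 = -(z ^ 2 / 4 / s) by field_simp]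
  · refine ((Real.GammaIntegral_convergent hθ).const_mul
      (Gamma (d / 2) * 2 ^ ((d : ℝ) - 1))).congr ?_
    filter_upwards [self_mem_ae_restrict measurableSet_Ioi] with s (hs : 0 < s)
    have h := integral_isotropicKernel_mul_gaussian hd le_rfl hs
    simp only [zero_mul, isotropicKernel, if_true, one_mul, zero_pow two_ne_zero, mul_zero, neg_zero,
      exp_zero, mul_one] at h
    have h1 : ∫ z in Ioi (0 : ℝ), ‖z ^ ((d : ℝ) - 1) * (s ^ (θ - (d : ℝ) / 2 - 1) *
        exp (-s - z ^ 2 / 4 / s))‖ = s ^ (θ - (d : ℝ) / 2 - 1) * exp (-s) *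
          (Gamma (d / 2) * 2 ^ ((d : ℝ) - 1) * s ^ ((d : ℝ) / 2)) := by
      rw [← h, ← integral_const_mul]
      refine setIntegral_congr_fun measurableSet_Ioi fun z (hz : 0 < z) => ?_
      rw [norm_of_nonneg (by positivity), hfac]
    rw [h1, show θ - (d : ℝ) / 2 - 1 = (θ - 1) - d / 2 by ring, rpow_sub hs (θ - 1)]
    have : s ^ ((d : ℝ) / 2) ≠ 0 := (rpow_pos_of_pos hs _).ne'
    field_simp

lemma integrableOn_rpow_mul_cauchyDensity {d : ℕ} (hd : 0 < d) {θ : ℝ} (hθ : 0 < θ) :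
    IntegrableOn (fun u => u ^ ((d : ℝ) - 1) * cauchyDensity d θ u) (Ioi 0) := by
  refine IntegrableOn.congr_fun (f := fun u => (2 ^ d * π ^ ((d : ℝ) / 2) * Gamma θ)⁻¹ *
    ∫ s in Ioi (0 : ℝ), u ^ ((d : ℝ) - 1) *
      (s ^ (θ - (d : ℝ) / 2 - 1) * exp (-s - u ^ 2 / 4 / s)))
    ((integrable_gaussian_gamma_mixture hd hθ).integral_prod_left.const_mul _)
    (fun u (hu : 0 < u) => ?_) measurableSet_Ioi
  simp only
  rw [cauchyDensity_eq_gammaBessel_neg hu, gammaBessel, integral_const_mul]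
  ring

lemma cauchyDensity_nonneg {d : ℕ} {θ t : ℝ} (hθ : 0 < θ) (ht : 0 < t) :
    0 ≤ cauchyDensity d θ t := by
  have hΓ : 0 < Gamma θ := Gamma_pos_of_pos hθ
  rw [cauchyDensity_eq_gammaBessel_neg ht]
  exact mul_nonneg (by positivity) (gammaBessel_nonneg _ _)

/-- Fubini, with the Gaussian variable integrated first, leaves Euler's integral
`∫ s^(θ-1) exp (-(1 + r²) s) ds`. -/
lemma integral_isotropicKernel_isotropicSpectralMeasure {d : ℕ} (hd : 0 < d) {θ r : ℝ} (hθ : 0 < θ)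
    (hr : 0 ≤ r) :
    ∫ z, isotropicKernel d (r * z) ∂(isotropicSpectralMeasure d (cauchyDensity d θ)) =
      (1 + r ^ 2) ^ (-θ) := by
  have hd' : (0 : ℝ) < d := by exact_mod_cast hd
  have hΓθ : 0 < Gamma θ := Gamma_pos_of_pos hθ
  have hΓd : 0 < Gamma ((d : ℝ) / 2) := Gamma_pos_of_pos (by positivity)
  set Y : ℝ → ℝ := fun x => ∑' k, isotropicTerm d k x with hY
  set H : ℝ → ℝ → ℝ := fun z s => z ^ ((d : ℝ) - 1) *
    (s ^ (θ - (d : ℝ) / 2 - 1) * exp (-s - z ^ 2 / 4 / s)) with hH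
  have hHi := integrable_gaussian_gamma_mixture hd hθ
  have hYH : Integrable (Function.uncurry fun z s => Y (r * z) * H z s)
      ((volume.restrict (Ioi 0)).prod (volume.restrict (Ioi 0))) := by
    refine hHi.bdd_mul (c := 1) (f := fun p : ℝ × ℝ => Y (r * p.1)) ?_ ?_
    · exact ((measurable_tsum_isotropicTerm hd).comp
        (measurable_fst.const_mul r)).aestronglyMeasurable
    · exact Eventually.of_forall fun p => abs_tsum_isotropicTerm_le_one hd _
  have hinner : ∀ s ∈ Ioi (0 : ℝ), ∫ z in Ioi (0 : ℝ), Y (r * z) * H z s =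
      Gamma (d / 2) * 2 ^ ((d : ℝ) - 1) * (s ^ (θ - 1) * exp (-((1 + r ^ 2) * s))) := by
    intro s (hs : 0 < s)
    have h := integral_isotropicKernel_mul_gaussian hd hr hs
    have h1 : ∫ z in Ioi (0 : ℝ), Y (r * z) * H z s = s ^ (θ - (d : ℝ) / 2 - 1) * exp (-s) *
        (Gamma (d / 2) * 2 ^ ((d : ℝ) - 1) * s ^ ((d : ℝ) / 2) * exp (-(s * r ^ 2))) := by
      rw [← h, ← integral_const_mul]
      refine setIntegral_congr_fun measurableSet_Ioi fun z (hz : 0 < z) => ?_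
      simp only [hY, hH]
      rw [isotropicKernel_eq_tsum hd (by positivity), sub_eq_add_neg (-s), exp_add]
      ring
    rw [h1, show θ - (d : ℝ) / 2 - 1 = (θ - 1) - d / 2 by ring, rpow_sub hs (θ - 1),
      show -((1 + r ^ 2) * s) = -s + -(s * r ^ 2) by ring, exp_add]
    have : s ^ ((d : ℝ) / 2) ≠ 0 := (rpow_pos_of_pos hs _).ne'
    field_simp
  have hswap := integral_integral_swap hYH
  have hmain : ∫ z in Ioi (0 : ℝ), ∫ s in Ioi (0 : ℝ), Y (r * z) * H z s =
      Gamma (d / 2) * 2 ^ ((d : ℝ) - 1) * ((1 + r ^ 2) ^ (-θ) * Gamma θ) := by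
    rw [hswap, setIntegral_congr_fun measurableSet_Ioi hinner, integral_const_mul,
      integral_rpow_mul_exp_neg_mul_Ioi hθ (by positivity), one_div, inv_rpow (by positivity),
      rpow_neg (by positivity)]
  have hae : AEMeasurable (fun u : ℝ => ENNReal.ofReal (2 * π ^ ((d : ℝ) / 2) /
      Gamma ((d : ℝ) / 2) * (u ^ ((d : ℝ) - 1) * cauchyDensity d θ u)))
      (volume.restrict (Ioi 0)) :=
    ((integrableOn_rpow_mul_cauchyDensity hd hθ).aemeasurable.const_mul _).ennreal_ofReal
  rw [isotropicSpectralMeasure, integral_withDensity_eq_integral_toReal_smul₀ hae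
    (Eventually.of_forall fun _ => ENNReal.ofReal_lt_top)]
  have h2 : ∀ z ∈ Ioi (0 : ℝ), (ENNReal.ofReal (2 * π ^ ((d : ℝ) / 2) /
      Gamma ((d : ℝ) / 2) * (z ^ ((d : ℝ) - 1) * cauchyDensity d θ z))).toReal •
        isotropicKernel d (r * z) = (2 * π ^ ((d : ℝ) / 2) / Gamma ((d : ℝ) / 2)) *
          (2 ^ d * π ^ ((d : ℝ) / 2) * Gamma θ)⁻¹ * ∫ s in Ioi (0 : ℝ), Y (r * z) * H z s := by
    intro z (hz : 0 < z)
    have h0 := cauchyDensity_nonneg (d := d) hθ hz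
    rw [ENNReal.toReal_ofReal (by positivity), isotropicKernel_eq_tsum hd (by positivity),
      cauchyDensity_eq_gammaBessel_neg hz, gammaBessel]
    simp only [hH, integral_const_mul, smul_eq_mul, hY]
    ring
  rw [setIntegral_congr_fun measurableSet_Ioi h2, integral_const_mul, hmain,
    rpow_sub_one two_ne_zero, rpow_natCast]
  field_simp

/-! ### Small-frequency asymptotics of the spectral density -/

lemma tendsto_sq_div_four : Tendsto (fun t : ℝ => t ^ 2 / 4) (𝓝[>] 0) (𝓝[>] 0) := by
  refine tendsto_nhdsWithin_of_tendsto_nhds_of_eventually_within _ ?_ ?_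
  · have : Continuous fun t : ℝ => t ^ 2 / 4 := by fun_prop
    have h := this.tendsto 0
    norm_num at h
    exact h.mono_left nhdsWithin_le_nhds
  · filter_upwards [self_mem_nhdsWithin] with t (ht : 0 < t)
    show 0 < t ^ 2 / 4
    positivity

lemma cauchyDensity_div_sub_one {d : ℕ} {θ : ℝ} (hθ : 0 < θ)
    (hμ : 0 < (d : ℝ) / 2 - θ) {t : ℝ} (ht : 0 < t) :
    cauchyDensity d θ t / (c₂ d (2 * θ) * t ^ (2 * θ - d)) - 1 =
      (gammaBessel ((d : ℝ) / 2 - θ) (t ^ 2 / 4) - Gamma ((d : ℝ) / 2 - θ)) /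
        Gamma ((d : ℝ) / 2 - θ) := by
  have h1 : c₂ d (2 * θ) * t ^ (2 * θ - d) ≠ 0 :=
    mul_ne_zero (c₂_pos hθ hμ).ne' (rpow_pos_of_pos ht _).ne'
  rw [cauchyDensity_eq_c₂_mul hθ hμ ht, mul_div_cancel_left₀ _ h1, sub_div,
    div_self (Gamma_pos_of_pos hμ).ne']

lemma tendsto_cauchyDensity_of_lt_one {d : ℕ} {θ : ℝ} (hθ : 0 < θ) (hμ : 0 < (d : ℝ) / 2 - θ)
    (hμ1 : (d : ℝ) / 2 - θ < 1) :
    Tendsto (fun t => (cauchyDensity d θ t / (c₂ d (2 * θ) * t ^ (2 * θ - d)) - 1) /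
        t ^ (d - 2 * θ)) (𝓝[>] 0)
      (𝓝 (-(2 ^ (2 * θ - d) * Gamma (θ - ((d : ℝ) - 2) / 2) / Gamma (((d : ℝ) + 2) / 2 - θ)))) := by
  have hΓ := Gamma_pos_of_pos hμ
  have h := ((tendsto_gammaBessel_of_lt_one hμ hμ1).comp tendsto_sq_div_four).const_mul
    (2 ^ (2 * θ - (d : ℝ)) / Gamma ((d : ℝ) / 2 - θ))
  convert! h.congr' ?_ using 2
  · rw [show ((d : ℝ) + 2) / 2 - θ = (d / 2 - θ) + 1 by ring, Gamma_add_one hμ.ne',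
      show θ - ((d : ℝ) - 2) / 2 = 1 - (d / 2 - θ) by ring, mul_neg, div_mul_div_comm,
      mul_comm ((d : ℝ) / 2 - θ)]
  · filter_upwards [self_mem_nhdsWithin] with t (ht : 0 < t)
    have h1 : (t ^ 2 / 4) ^ ((d : ℝ) / 2 - θ) = t ^ ((d : ℝ) - 2 * θ) * 2 ^ (2 * θ - (d : ℝ)) := by
      rw [show t ^ 2 / 4 = (t / 2) ^ (2 : ℝ) by rw [rpow_two]; ring, ← rpow_mul (by positivity),
        show 2 * ((d : ℝ) / 2 - θ) = d - 2 * θ by ring, div_rpow ht.le zero_le_two,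
        show 2 * θ - (d : ℝ) = -(d - 2 * θ) by ring, rpow_neg zero_le_two, div_eq_mul_inv]
    have h2 : (2 : ℝ) ^ (2 * θ - (d : ℝ)) ≠ 0 := (rpow_pos_of_pos two_pos _).ne'
    have h3 : t ^ ((d : ℝ) - 2 * θ) ≠ 0 := (rpow_pos_of_pos ht _).ne'
    rw [cauchyDensity_div_sub_one hθ hμ ht, Function.comp_apply, h1,
      div_mul_div_comm, div_div, div_eq_div_iff (by positivity) (by positivity)]
    ring

lemma tendsto_cauchyDensity_of_one_lt {d : ℕ} {θ : ℝ} (hθ : 0 < θ) (hμ1 : 1 < (d : ℝ) / 2 - θ) :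
    Tendsto (fun t => (cauchyDensity d θ t / (c₂ d (2 * θ) * t ^ (2 * θ - d)) - 1) / t ^ 2) (𝓝[>] 0)
      (𝓝 (1 / (2 * (2 + 2 * θ - d)))) := by
  have hμ : 0 < (d : ℝ) / 2 - θ := by linarith
  have h := ((tendsto_gammaBessel_of_one_lt hμ1).comp tendsto_sq_div_four).const_mul
    (1 / (4 * Gamma ((d : ℝ) / 2 - θ)))
  convert! h.congr' ?_ using 2
  · have h1 : Gamma ((d : ℝ) / 2 - θ) = (d / 2 - θ - 1) * Gamma (d / 2 - θ - 1) := by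
      rw [← Gamma_add_one (by linarith), sub_add_cancel]
    have h2 : Gamma ((d : ℝ) / 2 - θ - 1) ≠ 0 := (Gamma_pos_of_pos (by linarith)).ne'
    have h3 : (d : ℝ) / 2 - θ - 1 ≠ 0 := by linarith
    have h4 : 2 + 2 * θ - (d : ℝ) ≠ 0 := by linarith
    rw [h1]
    generalize Gamma ((d : ℝ) / 2 - θ - 1) = G at h2 ⊢
    rw [show (d : ℝ) / 2 - θ - 1 = -(2 + 2 * θ - d) / 2 by ring]
    field_simp
    norm_num
  · filter_upwards [self_mem_nhdsWithin] with t (ht : 0 < t)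
    have hΓ := Gamma_pos_of_pos hμ
    rw [cauchyDensity_div_sub_one hθ hμ ht, Function.comp_apply, div_mul_div_comm, div_div,
      div_eq_div_iff (by positivity) (by positivity)]
    ring

lemma tendsto_cauchyDensity_of_eq_one {d : ℕ} {θ : ℝ} (hθ : 0 < θ) (hμ1 : (d : ℝ) / 2 - θ = 1) :
    Tendsto (fun t => (cauchyDensity d θ t / (c₂ d (2 * θ) * t ^ (2 * θ - d)) - 1) /
        (t ^ 2 * log t)) (𝓝[>] 0) (𝓝 (1 / 2)) := by
  have hlog : Tendsto (fun t : ℝ => 1 / 2 - log 4 / 4 * (log t)⁻¹) (𝓝[>] 0) (𝓝 (1 / 2)) := by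
    have := (tendsto_inv_atBot_zero.comp tendsto_log_nhdsGT_zero).const_mul (log 4 / 4)
    simpa only [Function.comp_def, mul_zero, sub_zero] using this.const_sub (1 / 2)
  have h := (tendsto_gammaBessel_one.comp tendsto_sq_div_four).mul hlog
  rw [one_mul] at h
  refine h.congr' ?_
  filter_upwards [Ioo_mem_nhdsGT one_pos] with t ht
  have ht0 : 0 < t := ht.1
  have hl : log t < 0 := log_neg ht.1 ht.2
  have h1 : log (t ^ 2 / 4) = 2 * log t - log 4 := by
    rw [log_div (by positivity) (by norm_num), log_pow]
    norm_num
  have h2 : 2 * log t - log 4 ≠ 0 := by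
    have : 0 < log 4 := log_pos (by norm_num)
    linarith
  have h3 := hl.ne
  rw [cauchyDensity_div_sub_one hθ (by linarith) ht0, Function.comp_apply, h1, hμ1, Gamma_one,
    div_one, show 1 / 2 - log 4 / 4 * (log t)⁻¹ = (2 * log t - log 4) / (4 * log t) by
      field_simp
      ring]
  field_simp

/-! ### The exponent `υ` -/

lemma cauchyUpsilon_of_lt_one {d : ℕ} {θ : ℝ} (hθ : 0 < θ) (hθd : θ < (d : ℝ) / 4) (δ : ℝ)
    (h : (d : ℝ) / 2 - θ < 1) : cauchyUpsilon d θ δ = d - 2 * θ := by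
  have hd4 : (d : ℝ) < 4 := by linarith
  have hd0 : (0 : ℝ) < d := by linarith
  have hd4' : d < 4 := by exact_mod_cast hd4
  have hd0' : 0 < d := by exact_mod_cast hd0
  rw [cauchyUpsilon, if_pos]
  interval_cases d
  · simp
  · simp
  · right; right
    norm_num at h ⊢
    linarith

lemma cauchyUpsilon_of_eq_one {d : ℕ} {θ : ℝ} (hθ : 0 < θ) (hθd : θ < (d : ℝ) / 4) (δ : ℝ)
    (h : (d : ℝ) / 2 - θ = 1) :
    d = 3 ∧ θ = 1 / 2 ∧ cauchyUpsilon d θ δ = 2 - δ := by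
  have hd4 : (d : ℝ) < 4 := by linarith
  have hd2 : (2 : ℝ) < d := by linarith
  have hd4' : d < 4 := by exact_mod_cast hd4
  have hd2' : 2 < d := by exact_mod_cast hd2
  obtain rfl : d = 3 := by omega
  have hθ' : θ = 1 / 2 := by push_cast at h; linarith
  subst hθ'
  refine ⟨rfl, rfl, ?_⟩
  simp [cauchyUpsilon]

lemma cauchyUpsilon_of_one_lt {d : ℕ} {θ : ℝ} (hθ : 0 < θ) (hθd : θ < (d : ℝ) / 4) (δ : ℝ)
    (h : 1 < (d : ℝ) / 2 - θ) :
    ¬ (d = 3 ∧ θ = 1 / 2) ∧ cauchyUpsilon d θ δ = 2 := by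
  have hd2 : (2 : ℝ) < d := by linarith
  have hd2' : 2 < d := by exact_mod_cast hd2
  have h3 : d = 3 → θ < 1 / 2 := by
    rintro rfl
    push_cast at h
    linarith
  have h4 : ¬ (d = 3 ∧ θ = 1 / 2) := fun hh => (h3 hh.1).ne hh.2
  refine ⟨h4, ?_⟩
  rw [cauchyUpsilon, if_neg, if_neg h4]
  rintro (h1 | h1 | h1)
  · omega
  · omega
  · exact absurd h1.2 (h3 h1.1).not_gt

lemma cauchyUpsilon_pos_le_two {d : ℕ} {θ : ℝ} (hθ : 0 < θ) (hθd : θ < (d : ℝ) / 4) (δ : ℝ)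
    (hδ0 : 0 < δ) (hδ2 : δ < 2) :
    0 < cauchyUpsilon d θ δ ∧ cauchyUpsilon d θ δ ≤ 2 := by
  rcases lt_trichotomy ((d : ℝ) / 2 - θ) 1 with h | h | h
  · rw [cauchyUpsilon_of_lt_one hθ hθd δ h]
    constructor <;> linarith
  · rw [(cauchyUpsilon_of_eq_one hθ hθd δ h).2.2]
    constructor <;> linarith
  · rw [(cauchyUpsilon_of_one_lt hθ hθd δ h).2]
    norm_num

lemma cauchyUpsilon_eq_min {d : ℕ} {θ : ℝ} (hθ : 0 < θ) (hθd : θ < (d : ℝ) / 4) (δ : ℝ)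
    (h : (d : ℝ) / 2 - θ ≠ 1) :
    cauchyUpsilon d θ δ = min 2 (d - 2 * θ) := by
  rcases h.lt_or_gt with h | h
  · rw [cauchyUpsilon_of_lt_one hθ hθd δ h, min_eq_right (by linarith)]
  · rw [(cauchyUpsilon_of_one_lt hθ hθd δ h).2, min_eq_left (by linarith)]

lemma cauchyUpsilon_of_natCast {d : ℕ} {θ : ℝ} (hθ : 0 < θ) (hθd : θ < (d : ℝ) / 4) (δ : ℝ)
    {l : ℕ} (h : (d : ℝ) / 2 - θ = l) :
    (d = 3 ∧ θ = 1 / 2 → cauchyUpsilon d θ δ = 2 - δ) ∧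
      (¬ (d = 3 ∧ θ = 1 / 2) → cauchyUpsilon d θ δ = 2) := by
  constructor
  · rintro ⟨rfl, rfl⟩
    simp [cauchyUpsilon]
  · intro h3
    have hl0 : (0 : ℝ) < l := by linarith
    have hl0' : 0 < l := by exact_mod_cast hl0
    have hl1 : l ≠ 1 := by
      rintro rfl
      have := cauchyUpsilon_of_eq_one hθ hθd δ (by simpa using h)
      exact h3 ⟨this.1, this.2.1⟩
    have hl2 : 1 < l := by omega
    refine (cauchyUpsilon_of_one_lt hθ hθd δ ?_).2
    rw [h]
    exact_mod_cast hl2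

/-! ### The slowly varying factor -/

lemma cauchyL_one_div {θ t : ℝ} (ht : 0 < t) : cauchyL θ (1 / t) = (1 + t ^ 2) ^ (-θ) := by
  rw [cauchyL, one_div, inv_rpow ht.le, rpow_neg ht.le, inv_inv, rpow_two]

lemma cauchyL_pos {θ t : ℝ} (ht : 0 < t) : 0 < cauchyL θ t := by
  unfold cauchyL
  positivity

lemma cauchyL_le_one {θ t : ℝ} (hθ : 0 < θ) (ht : 0 < t) : cauchyL θ t ≤ 1 := by
  refine rpow_le_one_of_one_le_of_nonpos ?_ (by linarith)
  have : 0 < t ^ (-2 : ℝ) := by positivity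
  linarith

lemma rpow_neg_mul_cauchyL {θ t : ℝ} (ht : 0 < t) :
    t ^ (-(2 * θ)) * cauchyL θ t = (1 + t ^ 2) ^ (-θ) := by
  have h : 1 + t ^ 2 = t ^ (2 : ℝ) * (1 + t ^ (-2 : ℝ)) := by
    rw [mul_add, ← rpow_add ht]
    norm_num
    ring
  rw [cauchyL, h, mul_rpow (by positivity) (by positivity), ← rpow_mul ht.le]
  ring_nf

lemma tendsto_cauchyL_atTop (θ : ℝ) : Tendsto (cauchyL θ) atTop (𝓝 1) := by
  have h1 : Tendsto (fun t : ℝ => 1 + t ^ (-2 : ℝ)) atTop (𝓝 1) := by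
    simpa using (tendsto_rpow_neg_atTop two_pos).const_add (1 : ℝ)
  have h2 := h1.rpow_const (p := -θ) (Or.inl one_ne_zero)
  rw [one_rpow] at h2
  exact h2

lemma isSlowlyVarying_cauchyL (θ : ℝ) : IsSlowlyVarying (cauchyL θ) where
  measurable := by
    unfold cauchyL
    fun_prop
  pos t ht := cauchyL_pos ht
  tendsto t ht := by
    have h1 := (tendsto_cauchyL_atTop θ).comp (tendsto_id.atTop_mul_const ht)
    simpa using! h1.div (tendsto_cauchyL_atTop θ) one_ne_zero

lemma abs_one_sub_cauchyL_div_le {θ r t : ℝ} (hθ : 0 < θ) (hr : 1 ≤ r) (ht : 1 ≤ t) :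
    |1 - cauchyL θ (t * r) / cauchyL θ r| ≤ θ * exp θ * r ^ (-2 : ℝ) := by
  have hr0 : 0 < r := by linarith
  have htr : 0 < t * r := by positivity
  set y := r ^ (-2 : ℝ) with hy
  set z := (t * r) ^ (-2 : ℝ) with hz
  have hy0 : 0 < y := by positivity
  have hz0 : 0 < z := by positivity
  have hy1 : y ≤ 1 := rpow_le_one_of_one_le_of_nonpos hr (by norm_num)
  have hzy : z ≤ y := rpow_le_rpow_of_nonpos hr0 (by nlinarith) (by norm_num)
  have hratio : cauchyL θ (t * r) / cauchyL θ r = ((1 + y) / (1 + z)) ^ θ := by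
    rw [cauchyL, cauchyL, ← hy, ← hz, rpow_neg (by positivity), rpow_neg (by positivity),
      div_rpow (by positivity) (by positivity)]
    have h1 : (1 + y) ^ θ ≠ 0 := by positivity
    have h2 : (1 + z) ^ θ ≠ 0 := by positivity
    field_simp
  have hge : 1 ≤ ((1 + y) / (1 + z)) ^ θ := by
    refine one_le_rpow ?_ hθ.le
    rw [one_le_div (by positivity)]
    linarith
  have hle : ((1 + y) / (1 + z)) ^ θ ≤ exp (θ * y) := by
    have h1 : (1 + y) / (1 + z) ≤ exp y := by
      refine (div_le_self (by positivity) (by linarith)).trans ?_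
      linarith [add_one_le_exp y]
    rw [mul_comm, exp_mul]
    exact rpow_le_rpow (by positivity) h1 hθ.le
  have h3 : exp (θ * y) - 1 ≤ θ * y * exp (θ * y) := by
    have := one_sub_exp_neg_le (θ * y)
    have h4 : exp (-(θ * y)) * exp (θ * y) = 1 := by rw [← exp_add]; simp
    nlinarith [exp_pos (θ * y)]
  have h5 : exp (θ * y) ≤ exp θ := exp_le_exp.2 (mul_le_of_le_one_right hθ.le hy1)
  rw [hratio, abs_sub_comm, abs_of_nonneg (by linarith)]
  calc _ ≤ θ * y * exp (θ * y) := by linarith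
    _ ≤ θ * y * exp θ := by gcongr
    _ = _ := by ring

/-! ### The remainder of the spectral density -/

/-- At `0` both `f(t) / (c₂ t^(2θ-d))` and `L(1/t)` are `1 + O(t^υ)`. -/
lemma isBigO_cauchyDensity_ratio_sub_one {d : ℕ} {θ δ : ℝ} (hθ : 0 < θ) (hθd : θ < (d : ℝ) / 4)
    (hδ0 : 0 < δ) :
    (fun t => cauchyDensity d θ t / (c₂ d (2 * θ) * t ^ (2 * θ - d)) - 1) =O[𝓝[>] 0]
      fun t => t ^ cauchyUpsilon d θ δ := by
  have hμ : 0 < (d : ℝ) / 2 - θ := by linarith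
  rcases lt_trichotomy ((d : ℝ) / 2 - θ) 1 with h | h | h
  · rw [cauchyUpsilon_of_lt_one hθ hθd δ h]
    refine isBigO_of_div_tendsto_nhds ?_ _ (tendsto_cauchyDensity_of_lt_one hθ hμ h)
    filter_upwards [self_mem_nhdsWithin] with t (ht : 0 < t) h0
    exact absurd h0 (rpow_pos_of_pos ht _).ne'
  · rw [(cauchyUpsilon_of_eq_one hθ hθd δ h).2.2]
    have h1 : (fun t => cauchyDensity d θ t / (c₂ d (2 * θ) * t ^ (2 * θ - d)) - 1) =O[𝓝[>] 0]
        fun t => t ^ 2 * log t := by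
      refine isBigO_of_div_tendsto_nhds ?_ _ (tendsto_cauchyDensity_of_eq_one hθ h)
      filter_upwards [Ioo_mem_nhdsGT one_pos] with t ht h0
      exact absurd h0 (mul_ne_zero (pow_pos ht.1 2).ne' (log_neg ht.1 ht.2).ne)
    refine h1.trans ?_
    have h2 := (isBigO_refl (fun t : ℝ => t ^ 2) (𝓝[>] 0)).mul
      (isLittleO_log_rpow_nhdsGT_zero (r := -δ) (by linarith)).isBigO
    refine h2.congr' EventuallyEq.rfl ?_
    filter_upwards [self_mem_nhdsWithin] with t (ht : 0 < t)
    rw [sub_eq_add_neg, rpow_add ht, rpow_two]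
  · rw [(cauchyUpsilon_of_one_lt hθ hθd δ h).2]
    simp only [rpow_two]
    refine isBigO_of_div_tendsto_nhds ?_ _ (tendsto_cauchyDensity_of_one_lt hθ h)
    filter_upwards [self_mem_nhdsWithin] with t (ht : 0 < t) h0
    exact absurd h0 (pow_pos ht 2).ne'

lemma isBigO_cauchyL_one_div_sub_one {θ υ : ℝ} (hθ : 0 < θ) (hυ : υ ≤ 2) :
    (fun t => cauchyL θ (1 / t) - 1) =O[𝓝[>] 0] fun t => t ^ υ := by
  refine IsBigO.of_bound θ ?_
  filter_upwards [Ioo_mem_nhdsGT one_pos] with t ht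
  have ht0 : 0 < t := ht.1
  have h1 : cauchyL θ (1 / t) ≤ 1 := cauchyL_le_one hθ (by positivity)
  have h2 : exp (-(θ * t ^ 2)) ≤ cauchyL θ (1 / t) := by
    rw [cauchyL_one_div ht0, neg_mul_eq_neg_mul, mul_comm, exp_mul]
    exact rpow_le_rpow_of_nonpos (by positivity) (by linarith [add_one_le_exp (t ^ 2)])
      (by linarith)
  have h3 := one_sub_exp_neg_le (θ * t ^ 2)
  rw [norm_eq_abs, abs_sub_comm, abs_of_nonneg (by linarith), norm_of_nonneg (by positivity)]
  calc _ ≤ θ * t ^ 2 := by linarith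
    _ = θ * t ^ (2 : ℝ) := by rw [rpow_two]
    _ ≤ θ * t ^ υ := by
      gcongr θ * ?_
      exact rpow_le_rpow_of_exponent_ge ht0 ht.2.le hυ

lemma isBigO_cauchyDensity_ratio_atTop {d : ℕ} {θ : ℝ} (hθ : 0 < θ) (hμ : 0 < (d : ℝ) / 2 - θ) :
    (fun t => cauchyDensity d θ t / (c₂ d (2 * θ) * t ^ (2 * θ - d))) =O[atTop]
      fun t => cauchyL θ (1 / t) := by
  have hΓ := Gamma_pos_of_pos hμ
  have h1 : (fun t => cauchyDensity d θ t / (c₂ d (2 * θ) * t ^ (2 * θ - d))) =O[atTop]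
      fun t => exp (-(1 / 2) * t) := by
    refine IsBigO.of_bound (2 ^ ((d : ℝ) / 2 - θ)) ?_
    filter_upwards [eventually_gt_atTop 0] with t ht
    have h2 : c₂ d (2 * θ) * t ^ (2 * θ - d) ≠ 0 :=
      mul_ne_zero (c₂_pos hθ hμ).ne' (rpow_pos_of_pos ht _).ne'
    have h3 := gammaBessel_le hμ ht
    have h4 := gammaBessel_nonneg ((d : ℝ) / 2 - θ) (t ^ 2 / 4)
    rw [cauchyDensity_eq_c₂_mul hθ hμ ht, mul_div_cancel_left₀ _ h2,
      norm_of_nonneg (by positivity), norm_of_nonneg (exp_pos _).le, div_le_iff₀ hΓ,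
      show -(1 / 2) * t = -(t / 2) by ring]
    linarith
  refine h1.trans ((isLittleO_exp_neg_mul_rpow_atTop one_half_pos (-(2 * θ))).isBigO.trans ?_)
  refine IsBigO.of_bound (2 ^ θ) ?_
  filter_upwards [eventually_ge_atTop 1] with t ht
  have ht0 : 0 < t := by linarith
  rw [norm_of_nonneg (by positivity), norm_of_nonneg (cauchyL_pos (by positivity)).le,
    cauchyL_one_div ht0, show -(2 * θ) = 2 * -θ by ring, rpow_mul ht0.le, rpow_two]
  have h5 : (2 * t ^ 2) ^ (-θ) ≤ (1 + t ^ 2) ^ (-θ) :=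
    rpow_le_rpow_of_nonpos (by positivity) (by nlinarith) (by linarith)
  calc (t ^ 2) ^ (-θ) = 2 ^ θ * (2 * t ^ 2) ^ (-θ) := by
        rw [mul_rpow zero_le_two (by positivity), ← mul_assoc, ← rpow_add two_pos, add_neg_cancel,
          rpow_zero, one_mul]
    _ ≤ 2 ^ θ * (1 + t ^ 2) ^ (-θ) := by gcongr

lemma isBigO_cauchyDensity_remainder {d : ℕ} {θ δ : ℝ} (hθ : 0 < θ) (hθd : θ < (d : ℝ) / 4)
    (hδ0 : 0 < δ) (hδ2 : δ < 2) :
    (fun t => cauchyDensity d θ t - c₂ d (2 * θ) * t ^ (2 * θ - d) * cauchyL θ (1 / t))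
      =O[𝓝[>] 0 ⊔ atTop]
      fun t => t ^ (2 * θ - d) * cauchyL θ (1 / t) * min (t ^ cauchyUpsilon d θ δ) 1 := by
  have hμ : 0 < (d : ℝ) / 2 - θ := by linarith
  have hc := (c₂_pos hθ hμ).ne'
  obtain ⟨hυ0, hυ2⟩ := cauchyUpsilon_pos_le_two hθ hθd δ hδ0 hδ2
  set υ := cauchyUpsilon d θ δ with hυ
  set h : ℝ → ℝ := fun t => cauchyDensity d θ t / (c₂ d (2 * θ) * t ^ (2 * θ - d)) with hh
  -- After division by `c₂ t^(2θ-d)` it remains to compare `h` with `L(1/t)`.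
  have hred : ∀ l : Filter ℝ, (∀ᶠ t in l, 0 < t) →
      ((fun t => h t - cauchyL θ (1 / t)) =O[l] fun t => cauchyL θ (1 / t) * min (t ^ υ) 1) →
      (fun t => cauchyDensity d θ t - c₂ d (2 * θ) * t ^ (2 * θ - d) * cauchyL θ (1 / t)) =O[l]
        fun t => t ^ (2 * θ - d) * cauchyL θ (1 / t) * min (t ^ υ) 1 := by
    intro l hl ho
    have h1 := ((isBigO_refl (fun t : ℝ => t ^ (2 * θ - d)) l).mul ho).const_mul_left (c₂ d (2 * θ))
    refine h1.congr' ?_ (Eventually.of_forall fun t => by ring)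
    filter_upwards [hl] with t ht
    have h2 : t ^ (2 * θ - d) ≠ 0 := (rpow_pos_of_pos ht _).ne'
    simp only [hh]
    field_simp
  refine IsBigO.sup (hred _ self_mem_nhdsWithin ?_) (hred _ (eventually_gt_atTop 0) ?_)
  · have h1 : (fun t => h t - cauchyL θ (1 / t)) =O[𝓝[>] 0] fun t => t ^ υ :=
      ((isBigO_cauchyDensity_ratio_sub_one hθ hθd hδ0).sub
        (isBigO_cauchyL_one_div_sub_one hθ hυ2)).congr_left fun t => by simp only [hh]; ring
    refine h1.trans (IsBigO.of_bound (2 ^ θ) ?_)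
    filter_upwards [Ioo_mem_nhdsGT one_pos] with t ht
    have ht0 : 0 < t := ht.1
    have h2 : t ^ υ ≤ 1 := rpow_le_one ht0.le ht.2.le hυ0.le
    have h3 : (2 : ℝ) ^ (-θ) ≤ cauchyL θ (1 / t) := by
      rw [cauchyL_one_div ht0]
      exact rpow_le_rpow_of_nonpos (by positivity) (by nlinarith [ht.2]) (by linarith)
    rw [min_eq_left h2, norm_mul, ← mul_assoc]
    refine le_mul_of_one_le_left (norm_nonneg _) ?_
    rw [norm_of_nonneg (cauchyL_pos (by positivity)).le]
    calc (1 : ℝ) = 2 ^ θ * 2 ^ (-θ) := by rw [← rpow_add two_pos, add_neg_cancel, rpow_zero]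
      _ ≤ _ := by gcongr
  · refine ((isBigO_cauchyDensity_ratio_atTop hθ hμ).sub (isBigO_refl _ _)).congr'
      EventuallyEq.rfl ?_
    filter_upwards [eventually_ge_atTop 1] with t ht
    rw [min_eq_right (one_le_rpow ht hυ0.le), mul_one]

/-! ### The field -/

lemma covarianceAssumption_cauchy {d : ℕ} {Ω : Type*} [MeasurableSpace Ω] {θ : ℝ}
    (P : Measure Ω) [IsProbabilityMeasure P]
    (η : EuclideanSpace ℝ (Fin d) → Ω → ℝ)
    (hmeas : Measurable (Function.uncurry η)) (hgauss : IsGaussianProcess η P)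
    (hmean : ∀ x, ∫ ω, η x ω ∂P = 0)
    (hcov : ∀ x y, cov[η x, η y; P] = (1 + ‖x - y‖ ^ 2) ^ (-θ)) :
    CovarianceAssumption P η (2 * θ) (cauchyL θ) := by
  have hLp : ∀ x, MemLp (η x) 2 P := fun x => (hgauss.hasGaussianLaw_eval x).memLp_two
  have hprod : ∀ x y, ∫ ω, η x ω * η y ω ∂P = (1 + ‖x - y‖ ^ 2) ^ (-θ) := fun x y => by
    rw [← hcov, covariance_eq_sub (hLp x) (hLp y), hmean, hmean, mul_zero, sub_zero]
    rfl
  have hint : ∀ x y, Integrable (fun ω => η x ω * η y ω) P := fun x y =>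
    (hLp x).integrable_mul (hLp y)
  refine ⟨⟨hmeas, hLp, hmean, fun x => ?_, ⟨fun r => (1 + r ^ 2) ^ (-θ), hcov⟩⟩, hgauss, ?_, ?_,
    isSlowlyVarying_cauchyL θ⟩
  · have h1 : ∀ y, ∫ ω, (η y ω - η x ω) ^ 2 ∂P = 2 - 2 * (1 + ‖y - x‖ ^ 2) ^ (-θ) := fun y => by
      have h2 : ∀ ω, (η y ω - η x ω) ^ 2 =
          η y ω * η y ω + η x ω * η x ω - 2 * (η y ω * η x ω) := fun ω => by ring
      simp only [h2]
      rw [integral_sub (f := fun ω => η y ω * η y ω + η x ω * η x ω)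
        ((hint y y).add (hint x x)) ((hint y x).const_mul 2),
        integral_add (hint y y) (hint x x), integral_const_mul, hprod, hprod, hprod]
      simp only [sub_self, norm_zero, ne_eq, OfNat.ofNat_ne_zero, not_false_eq_true, zero_pow,
        add_zero, one_rpow]
      norm_num
    simp only [h1]
    have hc : Continuous fun y : EuclideanSpace ℝ (Fin d) => 2 - 2 * (1 + ‖y - x‖ ^ 2) ^ (-θ) :=
      continuous_const.sub (continuous_const.mul ((by fun_prop : Continuous fun y :
        EuclideanSpace ℝ (Fin d) => 1 + ‖y - x‖ ^ 2).rpow_const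
          fun y => Or.inl (by positivity)))
    simpa using hc.tendsto x
  · simp [hprod]
  · intro x hx
    rw [hprod, rpow_neg_mul_cauchyL (norm_pos_iff.2 hx), zero_sub, norm_neg]

lemma spectralDensityAssumption_cauchy {d : ℕ} {Ω : Type*} [MeasurableSpace Ω] {θ δ q : ℝ}
    (hθ : 0 < θ) (hθd : θ < (d : ℝ) / 4)
    (P : Measure Ω) (η : EuclideanSpace ℝ (Fin d) → Ω → ℝ)
    (hcov : ∀ x y, cov[η x, η y; P] = (1 + ‖x - y‖ ^ 2) ^ (-θ))
    (hδ0 : 0 < δ) (hδ2 : δ < 2) (hq0 : 0 < q) (hq2 : q ≤ 2) :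
    SpectralDensityAssumption P η (cauchyDensity d θ) (2 * θ) (cauchyL θ) (cauchyUpsilon d θ δ)
      q := by
  have hd : 0 < d := by
    have : (0 : ℝ) < d := by linarith
    exact_mod_cast this
  refine
    { spectralDensity :=
        { nonneg := fun u hu => cauchyDensity_nonneg hθ hu
          integrable := integrableOn_rpow_mul_cauchyDensity hd hθ
          covariance_eq := fun x y => ?_ }
      υ_pos := (cauchyUpsilon_pos_le_two hθ hθd δ hδ0 hδ2).1
      remainder := isBigO_cauchyDensity_remainder hθ hθd hδ0 hδ2
      locallyBounded := fun a _ => ⟨1, fun t ht _ => ?_⟩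
      slowlyVarying := isSlowlyVarying_cauchyL θ
      q_pos := hq0
      slowVariationRate := ⟨θ * exp θ, 0, 1, one_pos, fun r t hr ht => ?_⟩ }
  · rw [hcov, integral_isotropicKernel_isotropicSpectralMeasure hd hθ (norm_nonneg _)]
  · rw [abs_of_pos (cauchyL_pos ht)]
    exact cauchyL_le_one hθ ht
  · have hr0 : 0 < r := by linarith
    refine (abs_one_sub_cauchyL_div_le hθ hr ht).trans ?_
    rw [rpow_zero, mul_one, div_eq_mul_inv, ← rpow_neg hr0.le]
    gcongr

/-! ### The exponent `ϰ₁` -/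

/-- As the sum of reciprocals exceeds both `2/(d - 4θ)` and `1/υ ≥ 1/2`, its inverse is an
admissible value of `q`, and from there on it attains the minimum in `ϰ₁`. -/
lemma exists_forall_kappa₁_eq {d : ℕ} {θ υ : ℝ} (hθd : θ < (d : ℝ) / 4) (hυ0 : 0 < υ)
    (hυ2 : υ ≤ 2) :
    ∃ q₀ : ℝ, 0 < q₀ ∧ q₀ < min 2 ((d : ℝ) / 2 - 2 * θ) ∧ ∀ q : ℝ, q₀ ≤ q →
      kappa₁ d (2 * θ) υ q = 2 * (2 * ((d : ℝ) - 2 * (2 * θ))⁻¹ +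
        2 * ((d : ℝ) + 1 - 2 * (2 * θ))⁻¹ + υ⁻¹)⁻¹ := by
  have ha : 0 < (d : ℝ) - 2 * (2 * θ) := by linarith
  have hb : 0 < (d : ℝ) + 1 - 2 * (2 * θ) := by linarith
  have hυ2' : (2 : ℝ)⁻¹ ≤ υ⁻¹ := inv_anti₀ hυ0 hυ2
  have ha' : 0 < ((d : ℝ) - 2 * (2 * θ))⁻¹ := inv_pos.2 ha
  have hb' : 0 < ((d : ℝ) + 1 - 2 * (2 * θ))⁻¹ := inv_pos.2 hb
  have hυ' : 0 < υ⁻¹ := inv_pos.2 hυ0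
  refine ⟨(2 * ((d : ℝ) - 2 * (2 * θ))⁻¹ + 2 * ((d : ℝ) + 1 - 2 * (2 * θ))⁻¹ + υ⁻¹)⁻¹,
    by positivity, lt_min ?_ ?_, fun q hq => ?_⟩
  · rw [inv_lt_comm₀ (by positivity) two_pos]
    linarith
  · have h1 : ((d : ℝ) / 2 - 2 * θ)⁻¹ = 2 * ((d : ℝ) - 2 * (2 * θ))⁻¹ := by
      rw [show (d : ℝ) / 2 - 2 * θ = (d - 2 * (2 * θ)) / 2 by ring, inv_div, div_eq_mul_inv]
    rw [inv_lt_comm₀ (by positivity) (by linarith), h1]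
    linarith
  · rw [kappa₁, div_eq_mul_inv, div_eq_mul_inv, one_div, min_eq_right hq]

lemma exists_lt_kappa₁ {d : ℕ} {θ k : ℝ} (hθ : 0 < θ) (hθd : θ < (d : ℝ) / 4)
    (hk : k < 1 / 3 * min (2 * θ * (d - 2 * (2 * θ)) / (d - 2 * θ))
        (2 * (2 * ((d : ℝ) - 2 * (2 * θ))⁻¹ + 2 * ((d : ℝ) + 1 - 2 * (2 * θ))⁻¹ +
          (min 2 ((d : ℝ) - 2 * θ))⁻¹)⁻¹)) :
    ∃ δ q : ℝ, 0 < δ ∧ δ < 2 ∧ 0 < q ∧ q ≤ 2 ∧ q < (d : ℝ) / 2 - 2 * θ ∧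
      k < 1 / 3 * min (2 * θ * (d - 2 * (2 * θ)) / (d - 2 * θ))
        (kappa₁ d (2 * θ) (cauchyUpsilon d θ δ) q) := by
  have ha' : 0 < ((d : ℝ) - 2 * (2 * θ))⁻¹ := inv_pos.2 (by linarith)
  have hb' : 0 < ((d : ℝ) + 1 - 2 * (2 * θ))⁻¹ := inv_pos.2 (by linarith)
  -- It suffices to make the bound with `υ` in place of `min(2, d - 2θ)` exceed `k`.
  suffices h : ∃ δ : ℝ, 0 < δ ∧ δ < 2 ∧
      k < 1 / 3 * min (2 * θ * (d - 2 * (2 * θ)) / (d - 2 * θ))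
        (2 * (2 * ((d : ℝ) - 2 * (2 * θ))⁻¹ + 2 * ((d : ℝ) + 1 - 2 * (2 * θ))⁻¹ +
          (cauchyUpsilon d θ δ)⁻¹)⁻¹) by
    obtain ⟨δ, hδ0, hδ2, hlt⟩ := h
    obtain ⟨hυ0, hυ2⟩ := cauchyUpsilon_pos_le_two hθ hθd δ hδ0 hδ2
    obtain ⟨q₀, hq0, hq, hκ⟩ := exists_forall_kappa₁_eq hθd hυ0 hυ2
    refine ⟨δ, q₀, hδ0, hδ2, hq0, (hq.trans_le (min_le_left _ _)).le,
      hq.trans_le (min_le_right _ _), ?_⟩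
    rwa [hκ q₀ le_rfl]
  by_cases h1 : (d : ℝ) / 2 - θ = 1
  · -- Here `υ = 2 - δ`, and the bound is continuous in `δ` at `0`.
    have hmin : min 2 ((d : ℝ) - 2 * θ) = 2 - 0 := by
      rw [sub_zero]
      exact min_eq_left (by linarith)
    rw [hmin] at hk
    have hc : ContinuousAt (fun δ : ℝ => 1 / 3 * min (2 * θ * (d - 2 * (2 * θ)) / (d - 2 * θ))
        (2 * (2 * ((d : ℝ) - 2 * (2 * θ))⁻¹ + 2 * ((d : ℝ) + 1 - 2 * (2 * θ))⁻¹ +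
          (2 - δ)⁻¹)⁻¹)) 0 := by
      have h2 : ContinuousAt (fun δ : ℝ => (2 - δ)⁻¹) 0 :=
        (continuousAt_const.sub continuousAt_id).inv₀ (by norm_num)
      refine continuousAt_const.mul (continuousAt_const.min (continuousAt_const.mul
        ((continuousAt_const.add h2).inv₀ ?_)))
      simp only [Pi.add_apply, sub_zero]
      positivity
    have hev := (hc.eventually_const_lt hk).filter_mono (nhdsWithin_le_nhds (s := Ioi 0))
    obtain ⟨δ, hδ, hδ'⟩ := (hev.and (Ioo_mem_nhdsGT two_pos)).exists
    refine ⟨δ, hδ'.1, hδ'.2, ?_⟩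
    rwa [(cauchyUpsilon_of_eq_one hθ hθd δ h1).2.2]
  · refine ⟨1, one_pos, one_lt_two, ?_⟩
    rwa [cauchyUpsilon_eq_min hθ hθd 1 h1]

theorem mainTheorem4 {d : ℕ} {θ : ℝ} (hθ : 0 < θ) (hθd : θ < (d : ℝ) / 4)
    {Ω : Type*} [MeasurableSpace Ω] (P : Measure Ω) [IsProbabilityMeasure P]
    (η : EuclideanSpace ℝ (Fin d) → Ω → ℝ)
    (hmeas : Measurable (Function.uncurry η))
    (hgauss : IsGaussianProcess η P)
    (hmean : ∀ x, ∫ ω, η x ω ∂P = 0)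
    (hcov : ∀ x y, cov[η x, η y; P] = (1 + ‖x - y‖ ^ 2) ^ (-θ)) :
    -- the covariance assumption with `α = 2θ`, `L(t) = (1 + t^(-2))^(-θ)`
    CovarianceAssumption P η (2 * θ) (cauchyL θ) ∧
    -- the spectral density assumption, with the explicit density and the explicit `υ`, for all `q ≤ 2`
    (∀ δ q : ℝ, 0 < δ → δ < 2 → 0 < q → q ≤ 2 →
      SpectralDensityAssumption P η (cauchyDensity d θ) (2 * θ) (cauchyL θ) (cauchyUpsilon d θ δ) q) ∧
    -- the values of `υ` when `d/2 - θ` is not, respectively is, a natural number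
    (∀ δ : ℝ,
      ((¬ ∃ l : ℕ, (d : ℝ) / 2 - θ = l) → cauchyUpsilon d θ δ = min 2 (d - 2 * θ)) ∧
      ((∃ l : ℕ, (d : ℝ) / 2 - θ = l) →
        (d = 3 ∧ θ = 1 / 2 → cauchyUpsilon d θ δ = 2 - δ) ∧
        (¬ (d = 3 ∧ θ = 1 / 2) → cauchyUpsilon d θ δ = 2))) ∧
    -- the small-frequency asymptotics of the spectral density
    ((d : ℝ) / 2 - θ < 1 →
      Tendsto (fun t => (cauchyDensity d θ t / (c₂ d (2 * θ) * t ^ (2 * θ - d)) - 1) /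
        t ^ (d - 2 * θ)) (𝓝[>] 0)
        (𝓝 (-(2 ^ (2 * θ - d) * Real.Gamma (θ - ((d : ℝ) - 2) / 2) /
          Real.Gamma (((d : ℝ) + 2) / 2 - θ))))) ∧
    ((d : ℝ) / 2 - θ = 1 →
      Tendsto (fun t => (cauchyDensity d θ t / (c₂ d (2 * θ) * t ^ (2 * θ - d)) - 1) /
        (t ^ 2 * Real.log t)) (𝓝[>] 0) (𝓝 (1 / 2))) ∧
    (1 < (d : ℝ) / 2 - θ →
      Tendsto (fun t => (cauchyDensity d θ t / (c₂ d (2 * θ) * t ^ (2 * θ - d)) - 1) /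
        t ^ 2) (𝓝[>] 0) (𝓝 (1 / (2 * (2 + 2 * θ - d))))) ∧
    -- `ϰ₁` has the form without `q` for all admissible `q` close enough to `min(2, d/2 - α)`
    (∀ δ : ℝ, 0 < δ → δ < 2 →
      ∃ q₀ : ℝ, 0 < q₀ ∧ q₀ < min 2 ((d : ℝ) / 2 - 2 * θ) ∧
        ∀ q : ℝ, q₀ ≤ q → q ≤ 2 → q < (d : ℝ) / 2 - 2 * θ →
          kappa₁ d (2 * θ) (cauchyUpsilon d θ δ) q =
            2 * (2 * ((d : ℝ) - 2 * (2 * θ))⁻¹ + 2 * ((d : ℝ) + 1 - 2 * (2 * θ))⁻¹ +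
              (cauchyUpsilon d θ δ)⁻¹)⁻¹) ∧
    -- under the strict bound on `ϰ`, one may take `δ = 0`, that is, `υ = min(2, d - 2θ)`
    (∀ k : ℝ,
      k < 1 / 3 * min (2 * θ * (d - 2 * (2 * θ)) / (d - 2 * θ))
        (2 * (2 * ((d : ℝ) - 2 * (2 * θ))⁻¹ + 2 * ((d : ℝ) + 1 - 2 * (2 * θ))⁻¹ +
          (min 2 ((d : ℝ) - 2 * θ))⁻¹)⁻¹) →
      ∃ δ q : ℝ, 0 < δ ∧ δ < 2 ∧ 0 < q ∧ q ≤ 2 ∧ q < (d : ℝ) / 2 - 2 * θ ∧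
        k < 1 / 3 * min (2 * θ * (d - 2 * (2 * θ)) / (d - 2 * θ))
          (kappa₁ d (2 * θ) (cauchyUpsilon d θ δ) q)) := by
  have hμ : 0 < (d : ℝ) / 2 - θ := by linarith
  refine ⟨covarianceAssumption_cauchy P η hmeas hgauss hmean hcov,
    fun δ q hδ0 hδ2 hq0 hq2 => spectralDensityAssumption_cauchy hθ hθd P η hcov hδ0 hδ2 hq0 hq2,
    fun δ => ⟨fun h => cauchyUpsilon_eq_min hθ hθd δ fun h1 => h ⟨1, by simpa using h1⟩,
      fun ⟨l, hl⟩ => cauchyUpsilon_of_natCast hθ hθd δ hl⟩,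
    tendsto_cauchyDensity_of_lt_one hθ hμ, tendsto_cauchyDensity_of_eq_one hθ,
    tendsto_cauchyDensity_of_one_lt hθ, fun δ hδ0 hδ2 => ?_, fun k hk => exists_lt_kappa₁ hθ hθd hk⟩
  obtain ⟨hυ0, hυ2⟩ := cauchyUpsilon_pos_le_two hθ hθd δ hδ0 hδ2
  obtain ⟨q₀, hq0, hq, hκ⟩ := exists_forall_kappa₁_eq hθd hυ0 hυ2
  exact ⟨q₀, hq0, hq, fun q hq1 _ _ => hκ q hq1⟩
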